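/- **The Time-Stamped (TS) stack.** There are $n$ threads. Each thread owns a singly-linked list of nodes, initially empty, whose top pointer carries an ABA-counter that is incremented by every insertion. A node holds a value and a timestamp. Timestamps come from calls of $\mathit{newTimestamp}$: of two sequential calls the later one returns the bigger timestamp, and two overlapping calls return incomparable timestamps; there are also a greatest timestamp $\top$ and a least one $-1$. The list methods are atomic: $\mathit{insert}(v)$ puts a new node with value $v$ and timestamp $\top$ at the head; $\mathit{getYoungest}$ returns the head node (or $\mathrm{NULL}$ if the list is empty) together with the top pointer; $\mathit{remove}(\nu)$ removes the node $\nu$ and returns its value, or fails if $\nu$ is no longer in the list. * $\mathrm{push}(v)$: insert a node with value $v$ into the list of the executing thread; then call $\mathit{newTimestamp}$; then store the result as the timestamp of the node; return. * $\mathrm{pop}$: call $\mathit{newTimestamp}$ to get $\mathit{startTime}$; then repeat the following attempt until it succeeds. Set $\mathit{MaxTS}=-1$, with no candidate, and go through all lists, in any order. For each list call $\mathit{getYoungest}$. If the list is empty, record its top pointer. Otherwise read the timestamp $\tau$ of the returned node $\nu$: if $\mathit{startTime}<\tau$, end the attempt at once with $\mathit{remove}(\nu)$; else if $\mathit{MaxTS}<\tau$,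 make $\nu$ the candidate and set $\mathit{MaxTS}=\tau$. After the traversal, if there is a candidate, end the attempt with $\mathit{remove}$ of the candidate. If there is none, compare the top pointer of every list, one after another, with the recorded one: if one has changed, the attempt fails, otherwise the pop returns EMPTY. An attempt that ends with $\mathit{remove}$ succeeds iff the removal does, and the pop then returns the value of the removed node. An execution is a finite interleaving of the atomic steps of the threads, starting from empty lists and idle threads, in which an idle thread may call any method at any time. Its history is the sequence of its invocation and response events, each labelled with its thread and with an operation identifier that is unique to the operation. A history is complete if every invocation has a response. In a history $H$, $o\prec_H o'$ means that the response of $o$ precedes the invocation of $o'$; $o$ and $o'$ are interleaved if neither $o\prec_H o'$ nor $o'\prec_H o$. A push and a pop form an elimination pair if they are interleaved and the pop removes the node inserted by the push. A completion of $H$ is a complete history obtained from $H$ by removing some pending invocations and adding matching responses of the other pending operations at the end. $H$ is linearizable with respect to the LIFO specification if there are a completion $C$ of $H$ and a legal sequential history $S$ of the sequential stack (initially empty; pop returns EMPTY exactly on the empty stack) such that $C$ and $S$ have the same subsequence of events of every thread, and $o\prec_C o'$ implies $o\prec_S o'$. **Theorem 7.1.** 1. For every execution of the TS stack whose history is complete,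 the subhistory obtained by deleting all events of all operations that belong to an elimination pair is linearizable with respect to the LIFO specification. 2. The TS stack is linearizable: every history of the TS stack (complete or not) is linearizable with respect to the LIFO specification. -/

import Mathlib

namespace TSStack

universe u

/-! ### Histories and linearizability with respect to the LIFO stack -/

/-- The two methods of a stack, with their argument. -/
inductive Method (V : Type u) where
  | push (v : V)
  | pop

/-- Return values: `done` is the (void) result of a push; a pop returns a value or `empty`. -/
inductive Ret (V : Type u) where
  | done
  | val (v : V)
  | empty

/-- Invocation and response events: thread, method (or return value), operation identifier. -/
inductive Event (n : ℕ) (V : Type u) where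
  | inv (t : Fin n) (m : Method V) (o : ℕ)
  | ret (t : Fin n) (r : Ret V) (o : ℕ)

/-- The operation to which an event belongs. -/
def Event.op {n : ℕ} {V : Type u} : Event n V → ℕ
  | .inv _ _ o => o
  | .ret _ _ o => o

/-- The thread that performs an event. -/
def Event.thread {n : ℕ} {V : Type u} : Event n V → Fin n
  | .inv t _ _ => t
  | .ret t _ _ => t

/-- A history: a finite sequence of events, in the order in which they happen. -/
abbrev History (n : ℕ) (V : Type u) := List (Event n V)

namespace History

variable {n : ℕ} {V : Type u}

/-- Every invocation event has a matching response event. -/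
def Complete (H : History n V) : Prop :=
  ∀ t m o, Event.inv t m o ∈ H → ∃ r, Event.ret t r o ∈ H

/-- The operation `o` is invoked in `H` but has no response in `H`. -/
def Pending (H : History n V) (o : ℕ) : Prop :=
  (∃ t m, Event.inv t m o ∈ H) ∧ ¬ ∃ t r, Event.ret t r o ∈ H

/-- The happened-before order: the response event of `o` precedes the invocation event of `o'`. -/
def Precedes (H : History n V) (o o' : ℕ) : Prop :=
  ∃ t r t' m', List.Sublist [Event.ret t r o, Event.inv t' m' o'] H

/-- Neither operation precedes the other. -/
def Interleaved (H : History n V) (o o' : ℕ) : Prop :=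
  ¬ H.Precedes o o' ∧ ¬ H.Precedes o' o

/-- The maximal subsequence of events performed by the thread `t`. -/
def restrict (H : History n V) (t : Fin n) : History n V :=
  H.filter fun e => e.thread = t

/-- `C` is a completion of `H`: a complete history obtained by removing the invocations of some
pending operations (those in `D`) and adding at the end matching responses (`R`) of others, at
most one for each operation. -/
def IsCompletion (H C : History n V) : Prop :=
  ∃ (D : Finset ℕ) (R : History n V),
    (∀ o ∈ D, H.Pending o) ∧
    (∀ e ∈ R, ∃ t m r o, e = Event.ret t r o ∧ Event.inv t m o ∈ H ∧ H.Pending o ∧ o ∉ D) ∧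
    (R.map Event.op).Nodup ∧
    C = H.filter (fun e => e.op ∉ D) ++ R ∧
    C.Complete

/-- `LIFO s S`: `S` is a sequential history, each invocation being followed immediately by its
response, and it is a legal behaviour of the sequential stack with initial contents `s`
(top element first). -/
inductive LIFO : List V → History n V → Prop
  | nil (s : List V) : LIFO s []
  | push (s : List V) (t : Fin n) (v : V) (o : ℕ) (S : History n V) :
      LIFO (v :: s) S → LIFO s (.inv t (.push v) o :: .ret t .done o :: S)
  | pop (s : List V) (t : Fin n) (v : V) (o : ℕ) (S : History n V) :
      LIFO s S → LIFO (v :: s) (.inv t .pop o :: .ret t (.val v) o :: S)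
  | popEmpty (t : Fin n) (o : ℕ) (S : History n V) :
      LIFO [] S → LIFO [] (.inv t .pop o :: .ret t .empty o :: S)

/-- Linearizability with respect to the LIFO specification: some completion `C` has the same
thread subhistories as a legal sequential history `S` (which starts from the empty stack) that
preserves the happened-before order of `C`. (As `C` is complete, so is `S`.) -/
def Linearizable (H : History n V) : Prop :=
  ∃ C S : History n V, H.IsCompletion C ∧ LIFO [] S ∧
    (∀ t, C.restrict t = S.restrict t) ∧
    ∀ o o', C.Precedes o o' → S.Precedes o o'

end History

/-! ### Timestamps -/

/-- Timestamps. `minusOne` is the initial value `-1` of `MaxTS`, `top` is the maximal timestamp of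
a freshly inserted node, and `call b e` is the result of a call of `newTimestamp` that begins at
time `b` and ends at time `e`. -/
inductive Stamp where
  | minusOne
  | call (b e : ℕ)
  | top

/-- Comparison of timestamps. Of two sequential calls of `newTimestamp` the later one returns
the bigger timestamp, and overlapping calls return incomparable timestamps. These two properties
determine the comparison of any two generated timestamps. -/
def Stamp.Lt : Stamp → Stamp → Prop
  | .minusOne, .call _ _ => True
  | .minusOne, .top => True
  | .call _ e, .call b' _ => e < b'
  | .call _ _, .top => True
  | _, _ => False

/-! ### The algorithm -/

/-- A node. Its address is the identifier of the push operation that inserts it (every push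
inserts exactly one node); the `next` pointers are represented by the order in `Pool.nodes`. -/
structure Node (V : Type u) where
  val : V
  stamp : Stamp

/-- The list of one thread: its nodes, the head first, and the ABA-counter that annotates the top
pointer. -/
structure Pool where
  nodes : List ℕ
  aba : ℕ

/-- The annotated top pointer of a list; the pointer is `none` (`NULL`) if the list is empty. -/
def Pool.top (p : Pool) : Option ℕ × ℕ := (p.nodes.head?, p.aba)

/-- `insert`: put a node at the head; this changes the annotated top pointer to a new value. -/
def Pool.insert (p : Pool) (a : ℕ) : Pool := ⟨a :: p.nodes, p.aba + 1⟩

/-- The list after a successful `remove` of the node `a`, which need not be the head. -/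
def Pool.remove (p : Pool) (a : ℕ) : Pool := ⟨p.nodes.erase a, p.aba⟩

/-- The local variables of one call of `tryRem`: the lists already traversed, the array `empty`
(`none`: not assigned), the candidate (`CandList`, `CandNode`), and `MaxTS`. -/
structure Scan (n : ℕ) where
  visited : Finset (Fin n)
  empty : Fin n → Option (Option ℕ × ℕ)
  cand : Option (Fin n × ℕ)
  maxTS : Stamp

/-- The local variables after lines `T0`, `T1`. -/
def Scan.init (n : ℕ) : Scan n := ⟨∅, fun _ => none, none, .minusOne⟩

/-- The control state of a thread, with the values of its local variables. `o` is the identifier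
of the current operation, `st` the `startTime` of the current pop. -/
inductive Local (n : ℕ) (V : Type u) where
  /-- no operation is running -/
  | idle
  /-- before `E1`: `node := CurList.insert(v)` -/
  | pushInsert (o : ℕ) (v : V)
  /-- before `E2`: `ts := newTimestamp()` -/
  | pushBegin (o : ℕ)
  /-- during the call of `newTimestamp` that began at time `b` -/
  | pushStamp (o : ℕ) (b : ℕ)
  /-- before `E3`: `node.timestamp := ts` -/
  | pushSet (o : ℕ) (ts : Stamp)
  /-- before the return from push -/
  | pushDone (o : ℕ)
  /-- before `D0`: `startTime := newTimestamp()` -/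
  | popBegin (o : ℕ)
  /-- during the call of `newTimestamp` that began at time `b` -/
  | popStamp (o : ℕ) (b : ℕ)
  /-- before `D2`: `(success, v) := tryRem(startTime)` -/
  | popLoop (o : ℕ) (st : Stamp)
  /-- at the head of the loop `T2` -/
  | scan (o : ℕ) (st : Stamp) (s : Scan n)
  /-- before `T7`, with `CurList = l` and `CurNode = a` -/
  | readStamp (o : ℕ) (st : Stamp) (s : Scan n) (l : Fin n) (a : ℕ)
  /-- before `T15`: all lists have been traversed -/
  | decide (o : ℕ) (st : Stamp) (s : Scan n)
  /-- in the loop `T16`; the lists in `checked` have been compared -/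
  | check (o : ℕ) (st : Stamp) (empty : Fin n → Option (Option ℕ × ℕ)) (checked : Finset (Fin n))
  /-- before the atomic removal (`T9` or `T20`) of the node `a` from the list `l` -/
  | remove (o : ℕ) (st : Stamp) (l : Fin n) (a : ℕ)
  /-- before the return of `r` from pop (`D5`) -/
  | popDone (o : ℕ) (r : Ret V)

/-- A global state of the stack with `n` threads: shared memory (`pool`, `heap`), local states,
the time (number of steps executed so far), and two auxiliary variables that the algorithm does not
read: the history of the execution, and the map `matching`, which sends a pop operation to the push
operation whose node it has removed. -/
structure Config (n : ℕ) (V : Type u) where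
  pool : Fin n → Pool
  heap : ℕ → Option (Node V)
  loc : Fin n → Local n V
  clock : ℕ
  hist : History n V
  matching : ℕ → Option ℕ

namespace Config

variable {n : ℕ} {V : Type u}

/-- All lists are empty and all threads are idle. -/
def init (n : ℕ) (V : Type u) : Config n V :=
  ⟨fun _ => ⟨[], 0⟩, fun _ => none, fun _ => .idle, 0, [], fun _ => none⟩

/-- One step of the thread `t` to the local state `x`; time advances. -/
def goto (c : Config n V) (t : Fin n) (x : Local n V) : Config n V :=
  { c with loc := Function.update c.loc t x, clock := c.clock + 1 }

/-- Append an event to the history. -/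
def emit (c : Config n V) (e : Event n V) : Config n V :=
  { c with hist := c.hist ++ [e] }

/-- Write the list of the thread `l`. -/
def setPool (c : Config n V) (l : Fin n) (p : Pool) : Config n V :=
  { c with pool := Function.update c.pool l p }

/-- Write the node at the address `a`. -/
def setNode (c : Config n V) (a : ℕ) (x : Node V) : Config n V :=
  { c with heap := Function.update c.heap a (some x) }

/-- Record that the pop `o` has removed the node of the push `a`. -/
def setMatching (c : Config n V) (o a : ℕ) : Config n V :=
  { c with matching := Function.update c.matching o (some a) }

/-- One atomic step of one thread. Any interleaving is allowed, each idle thread may call any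
method at any time, and the loops `for each` go through the lists in any order. -/
inductive Step : Config n V → Config n V → Prop
  /-- call of push, with an unused operation identifier -/
  | pushCall (c : Config n V) (t : Fin n) (v : V) (o : ℕ) :
      c.loc t = .idle → (∀ e ∈ c.hist, e.op ≠ o) →
      Step c ((c.emit (.inv t (.push v) o)).goto t (.pushInsert o v))
  /-- `E1`: insert a node with timestamp `⊤` into the list of the executing thread -/
  | pushInsert (c : Config n V) (t : Fin n) (o : ℕ) (v : V) :
      c.loc t = .pushInsert o v →
      Step c (((c.setNode o ⟨v, .top⟩).setPool t ((c.pool t).insert o)).goto t (.pushBegin o))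
  /-- `E2`: `newTimestamp` begins -/
  | pushBegin (c : Config n V) (t : Fin n) (o : ℕ) :
      c.loc t = .pushBegin o →
      Step c (c.goto t (.pushStamp o c.clock))
  /-- `E2`: `newTimestamp` ends -/
  | pushStamp (c : Config n V) (t : Fin n) (o b : ℕ) :
      c.loc t = .pushStamp o b →
      Step c (c.goto t (.pushSet o (.call b c.clock)))
  /-- `E3`: assign the timestamp to the node -/
  | pushSet (c : Config n V) (t : Fin n) (o : ℕ) (ts : Stamp) (x : Node V) :
      c.loc t = .pushSet o ts → c.heap o = some x →
      Step c ((c.setNode o ⟨x.val, ts⟩).goto t (.pushDone o))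
  /-- return from push -/
  | pushReturn (c : Config n V) (t : Fin n) (o : ℕ) :
      c.loc t = .pushDone o →
      Step c ((c.emit (.ret t .done o)).goto t .idle)
  /-- call of pop, with an unused operation identifier -/
  | popCall (c : Config n V) (t : Fin n) (o : ℕ) :
      c.loc t = .idle → (∀ e ∈ c.hist, e.op ≠ o) →
      Step c ((c.emit (.inv t .pop o)).goto t (.popBegin o))
  /-- `D0`: `newTimestamp` begins -/
  | popBegin (c : Config n V) (t : Fin n) (o : ℕ) :
      c.loc t = .popBegin o →
      Step c (c.goto t (.popStamp o c.clock))
  /-- `D0`: `newTimestamp` ends -/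
  | popStamp (c : Config n V) (t : Fin n) (o b : ℕ) :
      c.loc t = .popStamp o b →
      Step c (c.goto t (.popLoop o (.call b c.clock)))
  /-- `D2`, `T0`, `T1`: call of `tryRem` -/
  | tryRem (c : Config n V) (t : Fin n) (o : ℕ) (st : Stamp) :
      c.loc t = .popLoop o st →
      Step c (c.goto t (.scan o st (Scan.init n)))
  /-- `T3` to `T6`: `getYoungest` finds the list `l` empty; its top pointer is recorded -/
  | scanEmpty (c : Config n V) (t : Fin n) (o : ℕ) (st : Stamp) (s : Scan n) (l : Fin n) :
      c.loc t = .scan o st s → l ∉ s.visited → (c.pool l).nodes = [] →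
      Step c (c.goto t (.scan o st
        { s with
          visited := insert l s.visited
          empty := Function.update s.empty l (some (c.pool l).top) }))
  /-- `T3`, `T4`: `getYoungest` returns the head node `a` of the list `l` -/
  | scanNode (c : Config n V) (t : Fin n) (o : ℕ) (st : Stamp) (s : Scan n) (l : Fin n) (a : ℕ) :
      c.loc t = .scan o st s → l ∉ s.visited → (c.pool l).nodes.head? = some a →
      Step c (c.goto t (.readStamp o st { s with visited := insert l s.visited } l a))
  /-- `T7`, `T8`: the timestamp of the node is bigger than `startTime`: go to `T9` -/
  | readElim (c : Config n V) (t : Fin n) (o : ℕ) (st : Stamp) (s : Scan n) (l : Fin n) (a : ℕ)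
      (x : Node V) :
      c.loc t = .readStamp o st s l a → c.heap a = some x → st.Lt x.stamp →
      Step c (c.goto t (.remove o st l a))
  /-- `T7`, `T8`, `T10` to `T14`: the node becomes the candidate -/
  | readCand (c : Config n V) (t : Fin n) (o : ℕ) (st : Stamp) (s : Scan n) (l : Fin n) (a : ℕ)
      (x : Node V) :
      c.loc t = .readStamp o st s l a → c.heap a = some x → ¬ st.Lt x.stamp →
      s.maxTS.Lt x.stamp →
      Step c (c.goto t (.scan o st { s with cand := some (l, a), maxTS := x.stamp }))
  /-- `T7`, `T8`, `T10`: the node does not become the candidate -/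
  | readSkip (c : Config n V) (t : Fin n) (o : ℕ) (st : Stamp) (s : Scan n) (l : Fin n) (a : ℕ)
      (x : Node V) :
      c.loc t = .readStamp o st s l a → c.heap a = some x → ¬ st.Lt x.stamp →
      ¬ s.maxTS.Lt x.stamp →
      Step c (c.goto t (.scan o st s))
  /-- `T2`: the loop ends when all lists have been traversed -/
  | scanEnd (c : Config n V) (t : Fin n) (o : ℕ) (st : Stamp) (s : Scan n) :
      c.loc t = .scan o st s → s.visited = Finset.univ →
      Step c (c.goto t (.decide o st s))
  /-- `T15`: there is no candidate -/
  | decideEmpty (c : Config n V) (t : Fin n) (o : ℕ) (st : Stamp) (s : Scan n) :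
      c.loc t = .decide o st s → s.cand = none →
      Step c (c.goto t (.check o st s.empty ∅))
  /-- `T15`: there is a candidate: go to `T20` -/
  | decideCand (c : Config n V) (t : Fin n) (o : ℕ) (st : Stamp) (s : Scan n) (l : Fin n)
      (a : ℕ) :
      c.loc t = .decide o st s → s.cand = some (l, a) →
      Step c (c.goto t (.remove o st l a))
  /-- `T16`, `T17`: the top pointer of the list `l` has not changed -/
  | checkSame (c : Config n V) (t : Fin n) (o : ℕ) (st : Stamp)
      (empty : Fin n → Option (Option ℕ × ℕ)) (checked : Finset (Fin n)) (l : Fin n) :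
      c.loc t = .check o st empty checked → l ∉ checked → some (c.pool l).top = empty l →
      Step c (c.goto t (.check o st empty (insert l checked)))
  /-- `T16` to `T18`: the top pointer of the list `l` has changed; `tryRem` fails -/
  | checkChanged (c : Config n V) (t : Fin n) (o : ℕ) (st : Stamp)
      (empty : Fin n → Option (Option ℕ × ℕ)) (checked : Finset (Fin n)) (l : Fin n) :
      c.loc t = .check o st empty checked → l ∉ checked → some (c.pool l).top ≠ empty l →
      Step c (c.goto t (.popLoop o st))
  /-- `T19`: all top pointers are unchanged; pop returns `EMPTY` -/
  | checkEnd (c : Config n V) (t : Fin n) (o : ℕ) (st : Stamp)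
      (empty : Fin n → Option (Option ℕ × ℕ)) (checked : Finset (Fin n)) :
      c.loc t = .check o st empty checked → checked = Finset.univ →
      Step c (c.goto t (.popDone o .empty))
  /-- `T9`, `T20`: the removal succeeds -/
  | removeSuccess (c : Config n V) (t : Fin n) (o : ℕ) (st : Stamp) (l : Fin n) (a : ℕ)
      (x : Node V) :
      c.loc t = .remove o st l a → a ∈ (c.pool l).nodes → c.heap a = some x →
      Step c (((c.setPool l ((c.pool l).remove a)).setMatching o a).goto t
        (.popDone o (.val x.val)))
  /-- `T9`, `T20`: the removal fails, because the node is no longer in the list -/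
  | removeFail (c : Config n V) (t : Fin n) (o : ℕ) (st : Stamp) (l : Fin n) (a : ℕ) :
      c.loc t = .remove o st l a → a ∉ (c.pool l).nodes →
      Step c (c.goto t (.popLoop o st))
  /-- `D5`: return from pop -/
  | popReturn (c : Config n V) (t : Fin n) (o : ℕ) (r : Ret V) :
      c.loc t = .popDone o r →
      Step c ((c.emit (.ret t r o)).goto t .idle)

/-- The state is reached by an execution of the stack; the histories of the TS stack are the
histories `c.hist` of the reachable states `c`. -/
def Reachable (c : Config n V) : Prop :=
  Relation.ReflTransGen Step (init n V) c

/-- The push `a` and the pop `o` are an elimination pair: the pop removes (and returns) the value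
inserted by the push, and the two operations are interleaved. -/
def IsElimPair (c : Config n V) (a o : ℕ) : Prop :=
  c.matching o = some a ∧ c.hist.Interleaved a o

open scoped Classical in
/-- The history without the events of the operations that belong to an elimination pair. -/
noncomputable def commonHist (c : Config n V) : History n V :=
  c.hist.filter fun e => ¬ ∃ a o, c.IsElimPair a o ∧ (e.op = a ∨ e.op = o)

end Config

end TSStack

/-! Attach times to an execution. A value `y` is stamped during an interval `[b y, e y]` inside its
push; its pop is invoked at `s y` and removes it at `r y`. Call the value solid if its push returns
before its pop, if any, begins. The essential guarantee of the algorithm is the invariant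
`Inv.order`: if a pop removes a solid value `z`, then every `y` that was inserted before the
invocation of the pop and not removed before `z` has a generated timestamp that is not bigger than
that of `z`. It holds because a traversal that ends with a candidate has bounded all such nodes:
each of them is the inspected head of its list or lies below it, and nodes of one list are stamped
in the order of insertion. A node found with a timestamp above the start time cannot belong to a
push that returned before the pop was invoked.

For solid values the legal order is then built by recursion. `exists_gap` yields a value `x` that is
minimal in the interval order and a time `t` in `[s x, r x]` such that every value stamped before
`t` has its pop invoked by `t`. Let U be the other values stamped before `t`, and W the rest. The
order is: push of `x`, operations on U, pop of `x`, operations on W. Operations on U are invoked by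
`t` and operations on W return after `t`, so real time is respected; all values of U are popped, so
the middle block leaves the stack as it was. This is `Timed.exists_list`.

A pop returning EMPTY has an instant at which all lists were empty, namely one between its traversal
and its comparison of the top pointers: an unchanged ABA-counter excludes insertions. Cutting the
values at this instant places the pop (`Timed.exists_list_of_empty`). A push and a pop of the same
value that overlap are put next to each other at an instant at which both are running
(`exists_list_of_elim`).

The construction works for any finite set `K` of operations that have returned or are matched,
provided `K` is closed under matching (`Inv.exists_completion`). The two statements are two choices
of `K`: the operations outside elimination pairs, and all operations that have returned or are
matched. -/

namespace TSStack

universe u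

open History

/-! ### Interval combinatorics: the gap lemma -/

/-- Among finitely many timed values, some value `x` that is minimal in the interval order of the
timestamps is being popped at a time `t` at which every other value that has been stamped is
already being popped. -/
theorem exists_gap {D : Finset ℕ} (hD : D.Nonempty) (b e s r : ℕ → ℕ)
    (hbe : ∀ y ∈ D, b y < e y) (hes : ∀ y ∈ D, e y < s y) (hsr : ∀ y ∈ D, s y ≤ r y)
    (hP : ∀ z ∈ D, ∀ y ∈ D, e z < b y → r z < r y → s z < b y) :
    ∃ x ∈ D, ∃ t, s x ≤ t ∧ t ≤ r x ∧ (∀ y ∈ D, ¬ e y < b x) ∧ ∀ y ∈ D, e y < t → s y ≤ t := by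
  classical
  -- Only invocation times of pops are considered. The latest of them is a gap, so there is a least
  -- one, and it serves as `t`.
  let gap : ℕ → Prop := fun t => (∃ y ∈ D, s y = t) ∧ ∀ y ∈ D, e y < t → s y ≤ t
  have hex : ∃ t, gap t := by
    obtain ⟨y, hy, hmax⟩ := D.exists_max_image s hD
    exact ⟨s y, ⟨y, hy, rfl⟩, fun z hz _ => hmax z hz⟩
  obtain ⟨⟨y₀, hy₀, hst⟩, hgap⟩ := Nat.find_spec hex
  have hmin : ∀ t, t < Nat.find hex → ¬ gap t := fun t ht => Nat.find_min hex ht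
  generalize Nat.find hex = t at hst hgap hmin
  -- Among the values whose pop is in progress at `t`, the one whose stamping ended first.
  obtain ⟨x, hx, hxmin⟩ := (D.filter fun y => s y ≤ t ∧ t ≤ r y).exists_min_image e
    ⟨y₀, by simp only [Finset.mem_filter]; exact ⟨hy₀, hst.le, hst ▸ hsr y₀ hy₀⟩⟩
  simp only [Finset.mem_filter] at hx hxmin
  obtain ⟨hxD, hsx, hxr⟩ := hx
  refine ⟨x, hxD, t, hsx, hxr, ?_, hgap⟩
  intro y hy hyx
  -- If something is stamped before `x`, let `m` be such a value whose pop is invoked last. If `m`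
  -- is not removed before `t`, it contradicts the choice of `x`. Otherwise `m` is removed before
  -- `x`, so `hP` gives `s m < b x`, and `s m` is a gap smaller than `t`.
  obtain ⟨m, hm, hmmax⟩ := (D.filter fun y => e y < b x).exists_max_image s
    ⟨y, by simp [hy, hyx]⟩
  simp only [Finset.mem_filter] at hm hmmax
  have hsm : s m ≤ r m := hsr m hm.1
  have hbx := hbe x hxD
  have hex' := hes x hxD
  by_cases hmt : t ≤ r m
  · have := hxmin m ⟨hm.1, hgap m hm.1 (by omega), hmt⟩
    omega
  · have h1 : s m < b x := hP m hm.1 x hxD hm.2 (by omega)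
    exact hmin (s m) (by omega) ⟨⟨m, hm.1, rfl⟩, fun z hz hzm => hmmax z ⟨hz, by omega⟩⟩

variable {n : ℕ} {V : Type u}

/-! ### Legal sequences for values that are pushed before they are popped -/

/-- The events of a push of `v`. -/
def IsPush (ev : ℕ → History n V) (o : ℕ) (v : V) : Prop :=
  ∃ t, ev o = [.inv t (.push v) o, .ret t .done o]

/-- The events of a pop of `v`. -/
def IsPop (ev : ℕ → History n V) (o : ℕ) (v : V) : Prop :=
  ∃ t, ev o = [.inv t .pop o, .ret t (.val v) o]

/-- The events of a pop that returns `EMPTY`. -/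
def IsPopEmpty (ev : ℕ → History n V) (o : ℕ) : Prop :=
  ∃ t, ev o = [.inv t .pop o, .ret t .empty o]

/-- The sequence of operations `L` leaves every stack unchanged. -/
def Balanced (ev : ℕ → History n V) (L : List ℕ) : Prop :=
  ∀ s S, LIFO s S → LIFO s (L.flatMap ev ++ S)

theorem Balanced.append {ev : ℕ → History n V} {L M : List ℕ} (hL : Balanced ev L)
    (hM : Balanced ev M) : Balanced ev (L ++ M) := by
  intro s S h
  simpa using hL s _ (hM s S h)

theorem Balanced.cons {ev : ℕ → History n V} {L : List ℕ} {x o : ℕ} {v : V}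
    (hx : IsPush ev x v) (ho : IsPop ev o v) (hL : Balanced ev L) :
    Balanced ev (x :: (L ++ [o])) := by
  intro s S h
  obtain ⟨t, hx⟩ := hx
  obtain ⟨t', ho⟩ := ho
  have := LIFO.push s t v x _ (hL (v :: s) _ (LIFO.pop s t' v o S h))
  simpa [hx, ho] using this

/-- An operation that is over before `o` begins must not stand behind `o`. -/
def Compatible (inv ret : ℕ → ℕ) (o o' : ℕ) : Prop :=
  o ≠ o' ∧ ¬ ret o' < inv o

/-- The timing of a set `D` of pushes with timestamps `[b, e]` and of the pops `pop` that
remove their values at the times `r`; an unmatched value has `s = r = N`. -/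
structure Timed (ev : ℕ → History n V) (inv ret b e s r : ℕ → ℕ) (pop : ℕ → Option ℕ) (N : ℕ)
    (D : Finset ℕ) : Prop where
  push : ∀ y ∈ D, ∃ v, IsPush ev y v ∧ ∀ o, pop y = some o → IsPop ev o v
  inv_lt : ∀ y ∈ D, inv y < b y
  stamp_lt : ∀ y ∈ D, b y < e y
  lt_ret : ∀ y ∈ D, e y < ret y
  matched : ∀ y ∈ D, ∀ o, pop y = some o → inv o = s y ∧ r y < ret o ∧ r y < N ∧ o ∉ D
  stamp_lt_pop : ∀ y ∈ D, e y < s y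
  pop_le : ∀ y ∈ D, s y ≤ r y
  unmatched : ∀ y ∈ D, pop y = none → s y = N ∧ r y = N
  lt_end : ∀ y ∈ D, e y < N
  inj : ∀ y ∈ D, ∀ z ∈ D, ∀ o, pop y = some o → pop z = some o → y = z
  order : ∀ z ∈ D, ∀ y ∈ D, e z < b y → r z < r y → s z < b y

theorem Timed.mono {ev : ℕ → History n V} {inv ret b e s r : ℕ → ℕ} {pop : ℕ → Option ℕ} {N : ℕ}
    {D D' : Finset ℕ} (h : Timed ev inv ret b e s r pop N D) (hD : D' ⊆ D) :
    Timed ev inv ret b e s r pop N D' where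
  push y hy := h.push y (hD hy)
  inv_lt y hy := h.inv_lt y (hD hy)
  stamp_lt y hy := h.stamp_lt y (hD hy)
  lt_ret y hy := h.lt_ret y (hD hy)
  matched y hy o ho := by
    obtain ⟨h1, h2, h3, h4⟩ := h.matched y (hD hy) o ho
    exact ⟨h1, h2, h3, fun h => h4 (hD h)⟩
  stamp_lt_pop y hy := h.stamp_lt_pop y (hD hy)
  pop_le y hy := h.pop_le y (hD hy)
  unmatched y hy := h.unmatched y (hD hy)
  lt_end y hy := h.lt_end y (hD hy)
  inj y hy z hz := h.inj y (hD hy) z (hD hz)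
  order z hz y hy := h.order z (hD hz) y (hD hy)

/-- The operations on the values in `D`. -/
def OpsOf (pop : ℕ → Option ℕ) (D : Finset ℕ) (o : ℕ) : Prop :=
  o ∈ D ∨ ∃ y ∈ D, pop y = some o

/-- Both operations on a value `y` take place between `inv y` and the end, the push being in
progress at the time `e y` and the pop after that time. -/
theorem Timed.ops {ev : ℕ → History n V} {inv ret b e s r : ℕ → ℕ} {pop : ℕ → Option ℕ} {N : ℕ}
    {D : Finset ℕ} (h : Timed ev inv ret b e s r pop N D) {o : ℕ} (ho : OpsOf pop D o) :
    ∃ y ∈ D, (o = y ∨ pop y = some o) ∧ e y < ret o ∧ inv o ≤ s y ∧ (o = y → inv o < b y) := by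
  rcases ho with ho | ⟨y, hy, ho⟩
  · have := h.inv_lt o ho
    have := h.stamp_lt o ho
    have := h.stamp_lt_pop o ho
    exact ⟨o, ho, Or.inl rfl, h.lt_ret o ho, by omega, fun _ => by omega⟩
  · obtain ⟨h1, h2, h3, h4⟩ := h.matched y hy o ho
    have := h.stamp_lt_pop y hy
    have := h.pop_le y hy
    exact ⟨y, hy, Or.inr ho, by omega, h1.le, fun h => absurd (h ▸ hy) h4⟩

/-- Recursion on the gap `(x, t)`: push of `x`, values stamped before `t`, pop of `x`, remaining
values. The claim about balanced sequences is needed for the block between the push and the pop of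
`x`. Legality on every initial stack is needed because `x` may stay below that block forever. -/
theorem Timed.exists_list {ev : ℕ → History n V} {inv ret b e s r : ℕ → ℕ}
    {pop : ℕ → Option ℕ} {N : ℕ} {D : Finset ℕ} (h : Timed ev inv ret b e s r pop N D) :
    ∃ L : List ℕ, (∀ o, o ∈ L ↔ OpsOf pop D o) ∧ L.Pairwise (Compatible inv ret) ∧
      ((∀ y ∈ D, pop y ≠ none) → Balanced ev L) ∧ ∀ s, LIFO s (L.flatMap ev) := by
  classical
  induction D using Finset.strongInduction with
  | H D ih =>
  by_cases hD : D.Nonempty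
  swap
  · rw [Finset.not_nonempty_iff_eq_empty] at hD
    subst hD
    exact ⟨[], by simp [OpsOf], by simp, fun _ s S hS => by simpa using hS, fun s => .nil s⟩
  obtain ⟨x, hx, t, hst, htr, hxmin, hgap⟩ :=
    exists_gap hD b e s r h.stamp_lt h.stamp_lt_pop h.pop_le h.order
  have hUD : (D.erase x).filter (fun y => e y < t) ⊂ D :=
    (Finset.filter_subset _ _).trans_ssubset (Finset.erase_ssubset hx)
  have hWD : (D.erase x).filter (fun y => ¬ e y < t) ⊂ D :=
    (Finset.filter_subset _ _).trans_ssubset (Finset.erase_ssubset hx)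
  have hU := h.mono hUD.subset
  have hW := h.mono hWD.subset
  obtain ⟨LU, hLU, pU, bU, oU⟩ := ih _ hUD hU
  obtain ⟨LW, hLW, pW, bW, oW⟩ := ih _ hWD hW
  obtain ⟨v, hv, hvo⟩ := h.push x hx
  have hsx := h.stamp_lt_pop x hx
  have hbx := h.stamp_lt x hx
  have hix := h.inv_lt x hx
  have hrx := h.lt_ret x hx
  -- Every operation on `y` returns after `e y`, and `e y ≥ b x > inv x` by minimality of `x`.
  have hfirst : ∀ o, OpsOf pop D o → o ≠ x → Compatible inv ret x o := by
    intro o ho hox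
    obtain ⟨y, hy, _, h1, _⟩ := h.ops ho
    have := hxmin y hy
    exact ⟨hox.symm, by omega⟩
  -- The time `t` separates the blocks: operations of the first are invoked by `t`, those of the
  -- second return after `t`.
  have hUW : ∀ o ∈ LU, ∀ o' ∈ LW, Compatible inv ret o o' := by
    intro o ho o' ho'
    obtain ⟨y, hy, hyo, h1, h2, _⟩ := hU.ops ((hLU o).1 ho)
    obtain ⟨z, hz, hzo, h3, h4, _⟩ := hW.ops ((hLW o').1 ho')
    simp only [Finset.mem_filter, Finset.mem_erase] at hy hz
    have := hgap y hy.1.2 hy.2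
    refine ⟨?_, by omega⟩
    rintro rfl
    have hyz : y ≠ z := fun hyz => hz.2 (hyz ▸ hy.2)
    rcases hyo with rfl | hyo <;> rcases hzo with rfl | hzo
    · exact hyz rfl
    · exact (h.matched z hz.1.2 _ hzo).2.2.2 hy.1.2
    · exact (h.matched y hy.1.2 _ hyo).2.2.2 hz.1.2
    · exact hyz (h.inj y hy.1.2 z hz.1.2 _ hyo hzo)
  have hUops : ∀ o ∈ LU, OpsOf pop D o ∧ o ≠ x := by
    intro o ho
    rcases (hLU o).1 ho with h1 | ⟨y, hy, h1⟩
    · simp only [Finset.mem_filter, Finset.mem_erase] at h1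
      exact ⟨Or.inl h1.1.2, h1.1.1⟩
    · simp only [Finset.mem_filter, Finset.mem_erase] at hy
      exact ⟨Or.inr ⟨y, hy.1.2, h1⟩, fun hox => (h.matched y hy.1.2 o h1).2.2.2 (hox ▸ hx)⟩
  have hWops : ∀ o ∈ LW, OpsOf pop D o ∧ o ≠ x := by
    intro o ho
    rcases (hLW o).1 ho with h1 | ⟨y, hy, h1⟩
    · simp only [Finset.mem_filter, Finset.mem_erase] at h1
      exact ⟨Or.inl h1.1.2, h1.1.1⟩
    · simp only [Finset.mem_filter, Finset.mem_erase] at hy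
      exact ⟨Or.inr ⟨y, hy.1.2, h1⟩, fun hox => (h.matched y hy.1.2 o h1).2.2.2 (hox ▸ hx)⟩
  have hsplit : ∀ o, OpsOf pop D o ↔ o = x ∨ pop x = some o ∨ o ∈ LU ∨ o ∈ LW := by
    intro o
    constructor
    · rintro (ho | ⟨y, hy, ho⟩)
      · by_cases hox : o = x
        · exact Or.inl hox
        · right; right
          rw [hLU, hLW]
          by_cases het : e o < t
          · left; left; simp [*]
          · right; left; simp only [Finset.mem_filter, Finset.mem_erase]; exact ⟨⟨hox, ho⟩, het⟩
      · by_cases hyx : y = x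
        · exact Or.inr (Or.inl (hyx ▸ ho))
        · right; right
          rw [hLU, hLW]
          by_cases het : e y < t
          · left; right; exact ⟨y, by simp [*], ho⟩
          · right; right; refine ⟨y, ?_, ho⟩
            simp only [Finset.mem_filter, Finset.mem_erase]; exact ⟨⟨hyx, hy⟩, het⟩
    · rintro (rfl | ho | ho | ho)
      · exact Or.inl hx
      · exact Or.inr ⟨x, hx, ho⟩
      · exact (hUops o ho).1
      · exact (hWops o ho).1
  cases hpx : pop x with
  | none =>
    obtain ⟨h1, h2⟩ := h.unmatched x hx hpx
    -- An unmatched `x` forces `t = N`, and all values are stamped before `N`.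
    have hLW0 : LW = [] := by
      rw [List.eq_nil_iff_forall_not_mem]
      intro o ho
      obtain ⟨z, hz, _⟩ := hW.ops ((hLW o).1 ho)
      simp only [Finset.mem_filter, Finset.mem_erase] at hz
      have := h.lt_end z hz.1.2
      omega
    refine ⟨x :: LU, ?_, ?_, fun hall => absurd hpx (hall x hx), ?_⟩
    · intro o
      simp [hsplit o, hpx, hLW0]
    · exact List.pairwise_cons.2 ⟨fun o ho => hfirst o (hUops o ho).1 (hUops o ho).2, pU⟩
    · intro s
      obtain ⟨t', hv⟩ := hv
      simpa [hv] using LIFO.push s t' v x _ (oU (v :: s))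
  | some o =>
    obtain ⟨h1, h2, h3, h4⟩ := h.matched x hx o hpx
    -- Here `s y ≤ t ≤ r x < N`, whereas an unmatched value has `s y = N`.
    have hUm : ∀ y ∈ (D.erase x).filter (fun y => e y < t), pop y ≠ none := by
      intro y hy hy0
      simp only [Finset.mem_filter, Finset.mem_erase] at hy
      have := hgap y hy.1.2 hy.2
      have := (h.unmatched y hy.1.2 hy0).1
      omega
    have hox : o ≠ x := fun hox => h4 (hox ▸ hx)
    have hUo : ∀ q ∈ LU, Compatible inv ret q o := by
      intro q hq
      obtain ⟨y, hy, hyq, _, h5, _⟩ := hU.ops ((hLU q).1 hq)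
      simp only [Finset.mem_filter, Finset.mem_erase] at hy
      have := hgap y hy.1.2 hy.2
      refine ⟨?_, by omega⟩
      rintro rfl
      rcases hyq with rfl | hyq
      · exact h4 hy.1.2
      · exact hy.1.1 (h.inj y hy.1.2 x hx _ hyq hpx)
    have hoW : ∀ q ∈ LW, Compatible inv ret o q := by
      intro q hq
      obtain ⟨y, hy, hyq, h5, _⟩ := hW.ops ((hLW q).1 hq)
      simp only [Finset.mem_filter, Finset.mem_erase] at hy
      refine ⟨?_, by omega⟩
      rintro rfl
      rcases hyq with rfl | hyq
      · exact h4 hy.1.2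
      · exact hy.1.1 (h.inj y hy.1.2 x hx _ hyq hpx)
    have hbal := Balanced.cons hv (hvo o hpx) (bU hUm)
    refine ⟨x :: (LU ++ [o]) ++ LW, ?_, ?_, ?_, ?_⟩
    · intro q
      rw [hsplit q, hpx]
      simp only [List.mem_append, List.mem_cons, List.not_mem_nil, Option.some.injEq]
      tauto
    · simp only [List.cons_append, List.append_assoc, List.pairwise_cons, List.pairwise_append,
        List.mem_append, List.mem_cons, List.nil_append]
      refine ⟨?_, pU, ⟨hoW, pW⟩, ?_⟩
      · rintro q (hq | rfl | hq)
        · exact hfirst q (hUops q hq).1 (hUops q hq).2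
        · exact hfirst q (Or.inr ⟨x, hx, hpx⟩) hox
        · exact hfirst q (hWops q hq).1 (hWops q hq).2
      · rintro q hq q' (rfl | hq')
        · exact hUo q hq
        · exact hUW q hq q' hq'
    · intro hall
      refine hbal.append (bW fun y hy => hall y (hWD.subset hy))
    · intro s
      simpa using hbal s _ (oW s)

/-- Adding pops that return `EMPTY` at times `g` at which no value is stored. -/
theorem Timed.exists_list_of_empty {ev : ℕ → History n V} {inv ret b e s r : ℕ → ℕ}
    {pop : ℕ → Option ℕ} {N : ℕ} {D : Finset ℕ} (h : Timed ev inv ret b e s r pop N D)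
    (g : ℕ → ℕ) (E : Finset ℕ)
    (hE : ∀ o ∈ E, IsPopEmpty ev o ∧ inv o ≤ g o ∧ g o ≤ ret o ∧ ¬ OpsOf pop D o ∧
      ∀ y ∈ D, (pop y ≠ none ∧ r y < g o) ∨ g o ≤ e y) :
    ∃ L : List ℕ, (∀ o, o ∈ L ↔ OpsOf pop D o ∨ o ∈ E) ∧ L.Pairwise (Compatible inv ret) ∧
      ((∀ y ∈ D, pop y ≠ none) → ∀ S, LIFO [] S → LIFO [] (L.flatMap ev ++ S)) ∧
      LIFO [] (L.flatMap ev) := by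
  classical
  induction hcard : E.card generalizing D E with
  | zero =>
    rw [Finset.card_eq_zero] at hcard
    subst hcard
    obtain ⟨L, h1, h2, h3, h4⟩ := h.exists_list
    exact ⟨L, by simpa using h1, h2, fun hall S hS => h3 hall [] S hS, h4 []⟩
  | succ k ih =>
    -- The latest empty instant is split off: all other EMPTY pops then go in front of `o`, and the
    -- values stamped after it form a block without EMPTY pops.
    obtain ⟨o, ho, hmax⟩ := E.exists_max_image g (Finset.card_pos.1 (by omega))
    obtain ⟨⟨t, hev⟩, hig, hgr, hoD, hog⟩ := hE o ho
    have hU := h.mono (Finset.filter_subset (fun y => ¬ g o ≤ e y) D)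
    have hW := h.mono (Finset.filter_subset (fun y => g o ≤ e y) D)
    have hUops : ∀ q, OpsOf pop (D.filter fun y => ¬ g o ≤ e y) q → OpsOf pop D q := by
      rintro q (hq | ⟨y, hy, hq⟩)
      · exact Or.inl (Finset.mem_filter.1 hq).1
      · exact Or.inr ⟨y, (Finset.mem_filter.1 hy).1, hq⟩
    have hWops : ∀ q, OpsOf pop (D.filter fun y => g o ≤ e y) q → OpsOf pop D q := by
      rintro q (hq | ⟨y, hy, hq⟩)
      · exact Or.inl (Finset.mem_filter.1 hq).1
      · exact Or.inr ⟨y, (Finset.mem_filter.1 hy).1, hq⟩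
    obtain ⟨LU, hLU, pU, bU, -⟩ := ih hU (E.erase o) (by
      intro q hq
      obtain ⟨h1, h2, h3, h4, h5⟩ := hE q (Finset.mem_of_mem_erase hq)
      exact ⟨h1, h2, h3, fun h => h4 (hUops q h), fun y hy => h5 y (Finset.mem_filter.1 hy).1⟩)
      (by rw [Finset.card_erase_of_mem ho]; omega)
    obtain ⟨LW, hLW, pW, bW, oW⟩ := hW.exists_list
    have hUm : ∀ y ∈ D.filter (fun y => ¬ g o ≤ e y), pop y ≠ none := by
      intro y hy
      obtain ⟨hy, hy'⟩ := Finset.mem_filter.1 hy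
      exact ((hog y hy).resolve_right hy').1
    have hUinv : ∀ q ∈ LU, inv q ≤ g o ∧ q ≠ o := by
      intro q hq
      rcases (hLU q).1 hq with hq | hq
      · refine ⟨?_, fun h => hoD (h ▸ hUops q hq)⟩
        obtain ⟨y, hy, _, _, h1, _⟩ := hU.ops hq
        obtain ⟨hy, hy'⟩ := Finset.mem_filter.1 hy
        have := (hog y hy).resolve_right hy'
        have := h.pop_le y hy
        omega
      · have := hmax q (Finset.mem_of_mem_erase hq)
        have := (hE q (Finset.mem_of_mem_erase hq)).2.1
        exact ⟨by omega, Finset.ne_of_mem_erase hq⟩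
    have hWret : ∀ q ∈ LW, g o < ret q ∧ q ≠ o := by
      intro q hq
      obtain ⟨y, hy, _, h1, _⟩ := hW.ops ((hLW q).1 hq)
      have := (Finset.mem_filter.1 hy).2
      exact ⟨by omega, fun h => hoD (h ▸ hWops q ((hLW q).1 hq))⟩
    have hne : ∀ q ∈ LU, q ∉ LW := by
      intro q hq hqW
      rcases (hLU q).1 hq with hq | hq
      · obtain ⟨y, hy, hyq, _, h2, _⟩ := hU.ops hq
        obtain ⟨z, hz, hzq, h3, h4, _⟩ := hW.ops ((hLW q).1 hqW)
        obtain ⟨hy, hy'⟩ := Finset.mem_filter.1 hy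
        obtain ⟨hz, hz'⟩ := Finset.mem_filter.1 hz
        have hyz : y ≠ z := fun hyz => hy' (hyz ▸ hz')
        rcases hyq with rfl | hyq <;> rcases hzq with rfl | hzq
        · exact hyz rfl
        · exact (h.matched z hz _ hzq).2.2.2 hy
        · exact (h.matched y hy _ hyq).2.2.2 hz
        · exact hyz (h.inj y hy z hz _ hyq hzq)
      · exact (hE q (Finset.mem_of_mem_erase hq)).2.2.2.1 (hWops q ((hLW q).1 hqW))
    refine ⟨LU ++ o :: LW, ?_, ?_, ?_, ?_⟩
    · intro q
      simp only [List.mem_append, List.mem_cons, hLU, hLW]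
      constructor
      · rintro ((hq | hq) | rfl | hq)
        · exact Or.inl (hUops q hq)
        · exact Or.inr (Finset.mem_of_mem_erase hq)
        · exact Or.inr ho
        · exact Or.inl (hWops q hq)
      · rintro ((hq | ⟨y, hy, hq⟩) | hq)
        · by_cases hg : g o ≤ e q
          · exact Or.inr (Or.inr (Or.inl (Finset.mem_filter.2 ⟨hq, hg⟩)))
          · exact Or.inl (Or.inl (Or.inl (Finset.mem_filter.2 ⟨hq, hg⟩)))
        · by_cases hg : g o ≤ e y
          · exact Or.inr (Or.inr (Or.inr ⟨y, Finset.mem_filter.2 ⟨hy, hg⟩, hq⟩))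
          · exact Or.inl (Or.inl (Or.inr ⟨y, Finset.mem_filter.2 ⟨hy, hg⟩, hq⟩))
        · by_cases hqo : q = o
          · exact Or.inr (Or.inl hqo)
          · exact Or.inl (Or.inr (Finset.mem_erase.2 ⟨hqo, hq⟩))
    · simp only [List.pairwise_append, List.pairwise_cons, List.mem_cons]
      refine ⟨pU, ⟨?_, pW⟩, ?_⟩
      · intro q hq
        have := hWret q hq
        exact ⟨this.2.symm, by omega⟩
      · rintro q hq q' (rfl | hq')
        · have := hUinv q hq
          exact ⟨this.2, by omega⟩
        · have h1 := hUinv q hq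
          have h2 := hWret q' hq'
          exact ⟨fun h => hne q hq (h ▸ hq'), by omega⟩
    · intro hall S hS
      have := bU hUm _ (LIFO.popEmpty t o _
        (bW (fun y hy => hall y (Finset.mem_filter.1 hy).1) [] S hS))
      simpa [hev] using this
    · simpa [hev] using bU hUm _ (LIFO.popEmpty t o _ (oW []))

/-! ### Inserting overlapping pairs -/

/-- A legal sequential history stays legal when a push is inserted somewhere, immediately followed
by a pop of its value. -/
theorem LIFO.insert_pair {ev : ℕ → History n V} {a o : ℕ} {v : V} (ha : IsPush ev a v)
    (ho : IsPop ev o v) {L M : List ℕ} (hL : ∀ x ∈ L, (ev x).length = 2) {s : List V}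
    (h : LIFO s ((L ++ M).flatMap ev)) : LIFO s ((L ++ a :: o :: M).flatMap ev) := by
  induction L generalizing s with
  | nil =>
    obtain ⟨t, ha⟩ := ha
    obtain ⟨t', ho⟩ := ho
    simpa [ha, ho] using LIFO.push s t v a _ (LIFO.pop s t' v o _ h)
  | cons x L ih =>
    have ih' := fun s => @ih (fun y hy => hL y (List.mem_cons_of_mem _ hy)) s
    obtain ⟨p, q, hx⟩ := List.length_eq_two.1 (hL x List.mem_cons_self)
    simp only [List.cons_append, List.flatMap_cons, hx, List.nil_append] at h ⊢
    cases h with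
    | push _ _ _ _ _ h => exact .push _ _ _ _ _ (ih' _ h)
    | pop _ _ _ _ _ h => exact .pop _ _ _ _ _ (ih' _ h)
    | popEmpty _ _ _ h => exact .popEmpty _ _ _ (ih' _ h)

/-- Cut in front of the first operation `x` invoked after `t`. By compatibility nothing behind `x`
returns before `x` is invoked, so all of it returns after `t`. -/
theorem exists_split_at {inv ret : ℕ → ℕ} (t : ℕ) {L : List ℕ}
    (hL : L.Pairwise (Compatible inv ret)) (hlt : ∀ o ∈ L, inv o ≤ ret o) :
    ∃ L₁ L₂, L = L₁ ++ L₂ ∧ (∀ o ∈ L₁, inv o ≤ t) ∧ ∀ o ∈ L₂, t ≤ ret o := by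
  induction L with
  | nil => exact ⟨[], [], by simp⟩
  | cons x L ih =>
    obtain ⟨hx, hL⟩ := List.pairwise_cons.1 hL
    by_cases h : inv x ≤ t
    · obtain ⟨L₁, L₂, rfl, h1, h2⟩ := ih hL fun o ho => hlt o (List.mem_cons_of_mem _ ho)
      exact ⟨x :: L₁, L₂, rfl, by simpa [h] using h1, h2⟩
    · refine ⟨[], x :: L, rfl, by simp, ?_⟩
      intro o ho
      rcases List.mem_cons.1 ho with rfl | ho
      · have := hlt o List.mem_cons_self
        omega
      · have := (hx o ho).2
        omega

/-- Adding overlapping pairs of a push and a pop of the same value. -/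
theorem exists_list_of_elim {ev : ℕ → History n V} {inv ret : ℕ → ℕ} (P : List (ℕ × ℕ))
    {L : List ℕ} (hL : L.Pairwise (Compatible inv ret)) (hlt : ∀ o ∈ L, inv o ≤ ret o)
    (hlen : ∀ o ∈ L, (ev o).length = 2) (hLIFO : LIFO [] (L.flatMap ev))
    (hP : ∀ p ∈ P, (∃ v, IsPush ev p.1 v ∧ IsPop ev p.2 v) ∧ inv p.1 ≤ ret p.1 ∧
      inv p.2 ≤ ret p.2 ∧ inv p.1 ≤ ret p.2 ∧ inv p.2 ≤ ret p.1 ∧ p.1 ∉ L ∧ p.2 ∉ L)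
    (hdisj : (P.flatMap fun p => [p.1, p.2]).Nodup) :
    ∃ L' : List ℕ, (∀ o, o ∈ L' ↔ o ∈ L ∨ ∃ p ∈ P, o = p.1 ∨ o = p.2) ∧
      L'.Pairwise (Compatible inv ret) ∧ LIFO [] (L'.flatMap ev) := by
  induction P generalizing L with
  | nil => exact ⟨L, by simp, hL, hLIFO⟩
  | cons p P ih =>
    obtain ⟨⟨v, hv, hv'⟩, h1, h2, h3, h4, h5, h6⟩ := hP p List.mem_cons_self
    -- At the later of the two invocations both operations of the pair have begun and neither has
    -- returned, so the pair may stand at this instant.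
    obtain ⟨L₁, L₂, rfl, hL₁, hL₂⟩ := exists_split_at (max (inv p.1) (inv p.2)) hL hlt
    simp only [List.flatMap_cons, List.cons_append, List.nil_append, List.nodup_cons,
      List.mem_cons, not_or, List.mem_flatMap, List.not_mem_nil, or_false, not_exists, not_and]
      at hdisj
    obtain ⟨⟨hne, hd1⟩, hd2, hd⟩ := hdisj
    have hlen1 : (ev p.1).length = 2 := by obtain ⟨t, hv⟩ := hv; simp [hv]
    have hlen2 : (ev p.2).length = 2 := by obtain ⟨t, hv⟩ := hv'; simp [hv]
    simp only [List.mem_append, not_or] at h5 h6 hlt hlen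
    rw [List.pairwise_append] at hL
    obtain ⟨L', hL', hp, hl⟩ := ih (L := L₁ ++ p.1 :: p.2 :: L₂) (by
        simp only [List.pairwise_append, List.pairwise_cons, List.mem_cons]
        refine ⟨hL.1, ⟨?_, ?_, hL.2.1⟩, ?_⟩
        · rintro q (rfl | hq)
          · exact ⟨hne, by omega⟩
          · have := hL₂ q hq
            exact ⟨fun h => h5.2 (h ▸ hq), by omega⟩
        · intro q hq
          have := hL₂ q hq
          exact ⟨fun h => h6.2 (h ▸ hq), by omega⟩
        · rintro q hq q' (rfl | rfl | hq')
          · have := hL₁ q hq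
            exact ⟨fun h => h5.1 (h ▸ hq), by omega⟩
          · have := hL₁ q hq
            exact ⟨fun h => h6.1 (h ▸ hq), by omega⟩
          · exact hL.2.2 q hq q' hq')
      (by
        intro q hq
        simp only [List.mem_append, List.mem_cons] at hq
        rcases hq with hq | rfl | rfl | hq
        · exact hlt q (Or.inl hq)
        · exact h1
        · exact h2
        · exact hlt q (Or.inr hq))
      (by
        intro q hq
        simp only [List.mem_append, List.mem_cons] at hq
        rcases hq with hq | rfl | rfl | hq
        · exact hlen q (Or.inl hq)
        · exact hlen1
        · exact hlen2
        · exact hlen q (Or.inr hq))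
      (LIFO.insert_pair hv hv' (fun q hq => hlen q (Or.inl hq)) hLIFO)
      (by
        intro q hq
        obtain ⟨k1, k2, k3, k4, k5, k6, k7⟩ := hP q (List.mem_cons_of_mem _ hq)
        simp only [List.mem_append, List.mem_cons, not_or] at k6 k7 ⊢
        have e1 := hd1 q hq
        have e2 := hd2 q hq
        exact ⟨k1, k2, k3, k4, k5, ⟨k6.1, fun h => e1.1 h.symm, fun h => e2.1 h.symm, k6.2⟩,
          ⟨k7.1, fun h => e1.2 h.symm, fun h => e2.2 h.symm, k7.2⟩⟩)
      hd
    refine ⟨L', ?_, hp, hl⟩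
    intro o
    rw [hL']
    simp only [List.mem_append, List.mem_cons, exists_eq_or_imp]
    generalize (∃ q ∈ P, o = q.1 ∨ o = q.2) = X
    clear * -
    tauto

/-! ### From compatible sequences of operations to histories -/

/-- The time of an event, given the times of the invocations and of the responses. -/
def Event.time (inv ret : ℕ → ℕ) : Event n V → ℕ
  | .inv _ _ o => inv o
  | .ret _ _ o => ret o

theorem eq_of_time_eq {C : History n V} {T : Event n V → ℕ}
    (hC : C.Pairwise fun e e' => T e < T e') {e e' : Event n V} (he : e ∈ C) (he' : e' ∈ C)
    (h : T e = T e') : e = e' := by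
  induction C with
  | nil => simp at he
  | cons x C ih =>
    obtain ⟨hx, hC⟩ := List.pairwise_cons.1 hC
    rcases List.mem_cons.1 he with rfl | he₁ <;> rcases List.mem_cons.1 he' with rfl | he₂
    · rfl
    · exact absurd h (hx _ he₂).ne
    · exact absurd h (hx _ he₁).ne'
    · exact ih hC he₁ he₂

theorem time_lt_of_sublist_pair {C : History n V} {T : Event n V → ℕ}
    (hC : C.Pairwise fun e e' => T e < T e') {e e' : Event n V} (h : [e, e'].Sublist C) :
    e ∈ C ∧ e' ∈ C ∧ T e < T e' := by
  refine ⟨h.subset (by simp), h.subset (by simp), ?_⟩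
  have := hC.sublist h
  simpa using this

/-- A sequence of operations that is compatible with the timing of a history has the same thread
subhistories and preserves the happened-before order. -/
theorem restrict_eq_and_precedes {C : History n V} {ev : ℕ → History n V} {inv ret : ℕ → ℕ}
    {L : List ℕ}
    (hC : C.Pairwise fun e e' => e.time inv ret < e'.time inv ret)
    (hev : ∀ o ∈ L, ∃ t m r, ev o = [.inv t m o, .ret t r o] ∧ inv o < ret o)
    (hmem : ∀ e, e ∈ C ↔ ∃ o ∈ L, e ∈ ev o)
    (hL : L.Pairwise (Compatible inv ret))
    (hseq : ∀ t m m' o o', Event.inv t m o ∈ C → Event.inv t m' o' ∈ C → inv o < inv o' →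
      ret o < inv o') :
    (∀ t, C.restrict t = History.restrict (L.flatMap ev) t) ∧
      ∀ o o', C.Precedes o o' → History.Precedes (L.flatMap ev) o o' := by
  constructor
  · intro t
    have h1 : (C.restrict t).Pairwise fun e e' => e.time inv ret < e'.time inv ret :=
      hC.sublist List.filter_sublist
    have h2 : (History.restrict (L.flatMap ev) t).Pairwise
        fun e e' => e.time inv ret < e'.time inv ret := by
      unfold History.restrict
      rw [List.pairwise_filter, List.pairwise_flatMap]
      constructor
      · intro o ho
        obtain ⟨t', m, r, h, hlt⟩ := hev o ho
        simp [h, Event.time, hlt]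
      · refine hL.imp_of_mem ?_
        intro o o' ho ho' hc x hx y hy hxt hyt
        obtain ⟨t₁, m, r, h, hlt⟩ := hev o ho
        obtain ⟨t₂, m', r', h', hlt'⟩ := hev o' ho'
        have i1 : Event.inv t₁ m o ∈ C := (hmem _).2 ⟨o, ho, by simp [h]⟩
        have i2 : Event.inv t₂ m' o' ∈ C := (hmem _).2 ⟨o', ho', by simp [h']⟩
        simp only [h, h', List.mem_cons, List.not_mem_nil, or_false] at hx hy
        simp only [decide_eq_true_eq] at hxt hyt
        have e1 : t₁ = t := by rcases hx with rfl | rfl <;> exact hxt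
        have e2 : t₂ = t := by rcases hy with rfl | rfl <;> exact hyt
        subst e1
        subst e2
        have hne : inv o ≠ inv o' := fun heq => hc.1 (by
          have := eq_of_time_eq hC i1 i2 heq
          simp only [Event.inv.injEq] at this
          exact this.2.2)
        -- Two operations of one thread do not overlap, and `Compatible` excludes the reversed
        -- order.
        have hlt2 : ret o < inv o' := by
          rcases lt_or_gt_of_ne hne with hlt | hgt
          · exact hseq _ _ _ _ _ i1 i2 hlt
          · exact absurd (hseq _ _ _ _ _ i2 i1 hgt) hc.2
        rcases hx with rfl | rfl <;> rcases hy with rfl | rfl <;> simp only [Event.time] <;> omega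
    -- Both subhistories are strictly increasing in time and have the same members, so they
    -- coincide.
    have hperm : (C.restrict t).Perm (History.restrict (L.flatMap ev) t) := by
      rw [List.perm_ext_iff_of_nodup (h1.imp fun h => by rintro rfl; omega)
        (h2.imp fun h => by rintro rfl; omega)]
      intro e
      simp [History.restrict, hmem]
    exact hperm.eq_of_pairwise (fun a b _ _ h h' => by omega) h1 h2
  · rintro o o' ⟨t, r, t', m', h⟩
    obtain ⟨h1, h2, h3⟩ := time_lt_of_sublist_pair hC h
    obtain ⟨q, hq, h1⟩ := (hmem _).1 h1
    obtain ⟨q', hq', h2⟩ := (hmem _).1 h2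
    obtain ⟨t₁, m₁, r₁, h, hlt⟩ := hev q hq
    obtain ⟨t₂, m₂, r₂, h', hlt'⟩ := hev q' hq'
    simp only [h, h', List.mem_cons, List.not_mem_nil, or_false, reduceCtorEq, false_or,
      Event.ret.injEq, Event.inv.injEq] at h1 h2
    obtain ⟨rfl, rfl, rfl⟩ := h1
    obtain ⟨rfl, rfl, rfl⟩ := h2
    simp only [Event.time] at h3
    refine ⟨t, r, t', m', ?_⟩
    clear hmem hC hseq
    have hlast : ∀ M : List ℕ, o' ∈ M → (∀ x ∈ M, x ∈ L) →
        [Event.inv t' m' o'].Sublist (M.flatMap ev) := by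
      intro M hM _
      rw [List.singleton_sublist, List.mem_flatMap]
      exact ⟨o', hM, by simp [h']⟩
    clear hev
    induction L with
    | nil => simp at hq
    | cons x L ih =>
      obtain ⟨hx, hL⟩ := List.pairwise_cons.1 hL
      rw [List.flatMap_cons]
      rcases List.mem_cons.1 hq with rfl | hq₁
      · rcases List.mem_cons.1 hq' with rfl | hq₂
        · omega
        · have := hlast L hq₂ fun x hx => List.mem_cons_of_mem _ hx
          simpa [h] using (List.Sublist.cons_cons (Event.ret t r o) this).cons (Event.inv t m₁ o)
      · rcases List.mem_cons.1 hq' with rfl | hq₂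
        · exact absurd h3 (hx o hq₁).2
        · exact (ih hL hq₁ hq₂ fun M h1 h2 =>
            hlast M h1 fun x hx => List.mem_cons_of_mem _ (h2 x hx)).trans
            (List.sublist_append_right _ _)

/-! ### Ghost times and the invariant of the algorithm -/

/-- The times at which operations are invoked and return, and at which nodes are inserted and
removed. -/
structure Ghost where
  inv : ℕ → ℕ
  ret : ℕ → ℕ
  ins : ℕ → ℕ
  rem : ℕ → ℕ

/-- The operation that a thread is executing. -/
def Local.op : Local n V → Option ℕ
  | .idle => none
  | .pushInsert o _ | .pushBegin o | .pushStamp o _ | .pushSet o _ | .pushDone o => some o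
  | .popBegin o | .popStamp o _ | .popLoop o _ | .scan o _ _ | .readStamp o _ _ _ _
  | .decide o _ _ | .check o _ _ _ | .remove o _ _ _ | .popDone o _ => some o

namespace Config

/-- The nodes of the list `l` that were inserted before the pop `o` began have timestamps that are
not bigger than `ts`. -/
def Settled (c : Config n V) (g : Ghost) (o : ℕ) (ts : Stamp) (l : Fin n) : Prop :=
  ∀ y ∈ (c.pool l).nodes, g.ins y < g.inv o →
    ∃ v b e, c.heap y = some ⟨v, .call b e⟩ ∧ ¬ ts.Lt (.call b e)

/-- The list `l` was empty at the time `k`. -/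
def EmptyAt (c : Config n V) (g : Ghost) (l : Fin n) (k : ℕ) : Prop :=
  ∀ y x m, c.heap y = some x → Event.inv l m y ∈ c.hist →
    k < g.ins y ∨ ∃ o, c.matching o = some y ∧ g.rem y < k

/-- The operation `o` of the thread `t` may return `r` at the time `k`. -/
def RetOK (c : Config n V) (g : Ghost) (t : Fin n) (o k : ℕ) : Ret V → Prop
  | .done => ∃ v b e, Event.inv t (.push v) o ∈ c.hist ∧ c.heap o = some ⟨v, .call b e⟩ ∧ e < k
  | .val v => Event.inv t .pop o ∈ c.hist ∧
      ∃ a st, c.matching o = some a ∧ c.heap a = some ⟨v, st⟩ ∧ g.rem a < k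
  | .empty => Event.inv t .pop o ∈ c.hist ∧ c.matching o = none ∧
      ∃ k₀, g.inv o < k₀ ∧ k₀ < k ∧ ∀ l, c.EmptyAt g l k₀

/-- The pop `o` of the thread `t` is running and has not removed a node. -/
def PopOK (c : Config n V) (t : Fin n) (o : ℕ) : Prop :=
  Event.inv t .pop o ∈ c.hist ∧ c.matching o = none

/-- The start time of the pop `o` was generated after the invocation. -/
def StartOK (g : Ghost) (o : ℕ) (st : Stamp) : Prop :=
  ∃ b e, st = .call b e ∧ g.inv o < b ∧ b < e

/-- `MaxTS` is the timestamp of the candidate. -/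
def CandOK (c : Config n V) (s : Scan n) : Prop :=
  (s.cand = none → s.maxTS = .minusOne) ∧
    ∀ l a, s.cand = some (l, a) → ∃ v b e, c.heap a = some ⟨v, .call b e⟩ ∧ s.maxTS = .call b e

/-- The recorded top pointer is that of an empty list, and if it is the current one, then the list
is empty. -/
def TopOK (c : Config n V) (em : Fin n → Option (Option ℕ × ℕ)) (l : Fin n) : Prop :=
  ∃ k, em l = some (none, k) ∧ k ≤ (c.pool l).aba ∧
    ((c.pool l).aba = k → (c.pool l).nodes = [])

/-- The invariant of the local state of the thread `t`. -/
def LocOK (c : Config n V) (g : Ghost) (t : Fin n) : Local n V → Prop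
  | .idle => True
  | .pushInsert o v => Event.inv t (.push v) o ∈ c.hist ∧ c.heap o = none
  | .pushBegin o => ∃ v, Event.inv t (.push v) o ∈ c.hist ∧ c.heap o = some ⟨v, .top⟩
  | .pushStamp o b => ∃ v, Event.inv t (.push v) o ∈ c.hist ∧ c.heap o = some ⟨v, .top⟩ ∧
      g.ins o < b ∧ b < c.clock
  | .pushSet o ts => ∃ v b e, Event.inv t (.push v) o ∈ c.hist ∧ c.heap o = some ⟨v, .top⟩ ∧
      ts = .call b e ∧ g.ins o < b ∧ b < e ∧ e < c.clock
  | .pushDone o => c.RetOK g t o c.clock .done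
  | .popBegin o => c.PopOK t o
  | .popStamp o b => c.PopOK t o ∧ g.inv o < b ∧ b < c.clock
  | .popLoop o st => c.PopOK t o ∧ StartOK g o st
  | .scan o st s => c.PopOK t o ∧ StartOK g o st ∧
      (∀ l ∈ s.visited, c.Settled g o s.maxTS l) ∧ c.CandOK s ∧
      (s.cand = none → ∀ l ∈ s.visited, c.TopOK s.empty l)
  -- The list `l` already counts as visited, but nothing is known about it until the timestamp of
  -- `a` is read. It suffices that `a` was the head: the older nodes that matter lie below it.
  | .readStamp o st s l a => c.PopOK t o ∧ StartOK g o st ∧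
      (∀ l' ∈ s.visited, l' ≠ l → c.Settled g o s.maxTS l') ∧ c.CandOK s ∧
      (s.cand = none → ∀ l' ∈ s.visited, l' ≠ l → c.TopOK s.empty l') ∧
      ∃ v sa, c.heap a = some ⟨v, sa⟩ ∧ Event.inv l (.push v) a ∈ c.hist ∧
        ∀ y ∈ (c.pool l).nodes, g.ins y < g.inv o → y = a ∨ g.ins y < g.ins a
  | .decide o st s => c.PopOK t o ∧ StartOK g o st ∧
      (∀ l, c.Settled g o s.maxTS l) ∧ c.CandOK s ∧ (s.cand = none → ∀ l, c.TopOK s.empty l)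
  -- The instant `k₀` is fixed before any comparison. For each list, a counter that still has the
  -- recorded value certifies emptiness at `k₀`.
  | .check o st em ch => c.PopOK t o ∧ StartOK g o st ∧ ∃ k₀, g.inv o < k₀ ∧ k₀ < c.clock ∧
      (∀ l ∈ ch, c.EmptyAt g l k₀) ∧
      ∀ l, ∃ k, em l = some (none, k) ∧ k ≤ (c.pool l).aba ∧
        ((c.pool l).aba = k → c.EmptyAt g l k₀)
  -- Either the push of `a` did not return before the pop was invoked, or `a` is a candidate whose
  -- timestamp bounds all lists. The second case yields `order` when the removal succeeds; in the
  -- first its hypothesis fails.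
  | .remove o st _ a => c.PopOK t o ∧ StartOK g o st ∧
      ((∀ t r, Event.ret t r a ∈ c.hist → g.inv o < g.ret a) ∨
        ∃ v b e, c.heap a = some ⟨v, .call b e⟩ ∧ ∀ l, c.Settled g o (.call b e) l)
  | .popDone o r => c.RetOK g t o c.clock r

/-- The invariant of the TS stack. -/
structure Inv (c : Config n V) (g : Ghost) : Prop where
  time_lt : ∀ e ∈ c.hist, e.time g.inv g.ret < c.clock
  sorted : c.hist.Pairwise fun e e' => e.time g.inv g.ret < e'.time g.inv g.ret
  ret_ok : ∀ t r o, Event.ret t r o ∈ c.hist → c.RetOK g t o (g.ret o) r ∧ g.inv o < g.ret o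
  seq : ∀ t m m' o o', Event.inv t m o ∈ c.hist → Event.inv t m' o' ∈ c.hist →
    g.inv o < g.inv o' → ∃ r, Event.ret t r o ∈ c.hist ∧ g.ret o < g.inv o'
  pending : ∀ t m o, Event.inv t m o ∈ c.hist →
    (∃ r, Event.ret t r o ∈ c.hist) ∨ (c.loc t).op = some o
  active : ∀ t o, (c.loc t).op = some o → ∀ t' r, Event.ret t' r o ∉ c.hist
  heap_ok : ∀ y v st, c.heap y = some ⟨v, st⟩ → (∃ t, Event.inv t (.push v) y ∈ c.hist) ∧
    g.inv y < g.ins y ∧ g.ins y < c.clock ∧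
    (st = .top ∨ ∃ b e, st = .call b e ∧ g.ins y < b ∧ b < e ∧ e < c.clock)
  pool_mem : ∀ l y, y ∈ (c.pool l).nodes →
    (∃ v st, c.heap y = some ⟨v, st⟩ ∧ Event.inv l (.push v) y ∈ c.hist) ∧
      ∀ o, c.matching o ≠ some y
  pool_compl : ∀ l m y x, c.heap y = some x → Event.inv l m y ∈ c.hist →
    (∀ o, c.matching o ≠ some y) → y ∈ (c.pool l).nodes
  pool_sorted : ∀ l, (c.pool l).nodes.Pairwise fun y z => g.ins z < g.ins y
  match_ok : ∀ o a, c.matching o = some a → (∃ t, Event.inv t .pop o ∈ c.hist) ∧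
    (∃ x, c.heap a = some x) ∧ g.ins a < g.rem a ∧ g.inv o < g.rem a ∧ g.rem a < c.clock
  match_inj : ∀ o o' a, c.matching o = some a → c.matching o' = some a → o = o'
  -- The hypothesis on `o'` says that `y` is not removed before `a`. It also covers values that are
  -- never removed, and a later removal of `y` does not affect it.
  order : ∀ o a t r, c.matching o = some a → Event.ret t r a ∈ c.hist → g.ret a < g.inv o →
    ∀ y x, c.heap y = some x → g.ins y < g.inv o →
    (∀ o', c.matching o' = some y → g.rem a < g.rem y) →
    ∃ b e, x.stamp = .call b e ∧ ∀ xa, c.heap a = some xa → ¬ xa.stamp.Lt (.call b e)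
  loc_ok : ∀ t, c.LocOK g t (c.loc t)

/-- What a step of the operation `i` may change in the shared state. -/
structure Ext (i : ℕ) (c : Config n V) (g : Ghost) (c' : Config n V) (g' : Ghost) : Prop where
  clock : c.clock < c'.clock
  hist_sub : ∀ e ∈ c.hist, e ∈ c'.hist
  hist_new : ∀ e ∈ c'.hist, e ∈ c.hist ∨ c.clock ≤ e.time g'.inv g'.ret
  inv_eq : ∀ t m o, Event.inv t m o ∈ c.hist → g'.inv o = g.inv o
  ret_eq : ∀ t r o, Event.ret t r o ∈ c.hist → g'.ret o = g.ret o
  heap_eq : ∀ y, y ≠ i → c'.heap y = c.heap y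
  heap_ext : ∀ y v st, c.heap y = some ⟨v, st⟩ → g'.ins y = g.ins y ∧
    ∃ st', c'.heap y = some ⟨v, st'⟩ ∧ (st ≠ .top → st' = st)
  heap_new : ∀ y x, c'.heap y = some x → (∃ v st, c.heap y = some ⟨v, st⟩) ∨ c.clock ≤ g'.ins y
  pool_sub : ∀ l y, y ∈ (c'.pool l).nodes → y ∈ (c.pool l).nodes ∨
    c.clock ≤ g'.ins y ∧ (c.pool l).aba < (c'.pool l).aba
  aba_le : ∀ l, (c.pool l).aba ≤ (c'.pool l).aba
  match_eq : ∀ o, o ≠ i → c'.matching o = c.matching o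
  match_ext : ∀ o a, c.matching o = some a → c'.matching o = some a ∧ g'.rem a = g.rem a

/-! ### Stability of assertions under steps of other operations -/

section Frame

variable {i : ℕ} {c c' : Config n V} {g g' : Ghost}

theorem Inv.inv_lt (h : c.Inv g) {t m o} (ho : Event.inv t m o ∈ c.hist) : g.inv o < c.clock :=
  h.time_lt _ ho

theorem Inv.inv_unique (h : c.Inv g) {t m o t' m'} (ho : Event.inv t m o ∈ c.hist)
    (ho' : Event.inv t' m' o ∈ c.hist) : t = t' ∧ m = m' := by
  have := eq_of_time_eq h.sorted ho ho' rfl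
  simpa using this

theorem Inv.ret_unique (h : c.Inv g) {t r o t' r'} (ho : Event.ret t r o ∈ c.hist)
    (ho' : Event.ret t' r' o ∈ c.hist) : t = t' ∧ r = r' := by
  have := eq_of_time_eq h.sorted ho ho' rfl
  simpa using this

theorem RetOK.exists_inv {t o k r} (h : c.RetOK g t o k r) : ∃ m, Event.inv t m o ∈ c.hist := by
  cases r with
  | done => obtain ⟨v, _, _, h, _⟩ := h; exact ⟨_, h⟩
  | val v => exact ⟨_, h.1⟩
  | empty => exact ⟨_, h.1⟩

theorem LocOK.exists_inv {t o x} (h : c.LocOK g t x) (hx : x.op = some o) :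
    ∃ m, Event.inv t m o ∈ c.hist := by
  cases x <;> simp only [Local.op, Option.some.injEq, reduceCtorEq] at hx <;> subst hx
  case pushDone => exact RetOK.exists_inv (g := g) (r := .done) h
  case popDone => exact RetOK.exists_inv (g := g) h
  case pushInsert => exact ⟨_, h.1⟩
  case pushBegin => exact ⟨_, h.choose_spec.1⟩
  case pushStamp => exact ⟨_, h.choose_spec.1⟩
  case pushSet => obtain ⟨v, _, _, h, _⟩ := h; exact ⟨_, h⟩
  case popBegin => exact ⟨_, h.1⟩
  all_goals exact ⟨_, h.1.1⟩

/-- Nodes inserted now are too young to count, and a generated timestamp is never overwritten. -/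
theorem Ext.settled (h : Ext i c g c' g') (hc : c.Inv g) {t m o ts l}
    (ho : Event.inv t m o ∈ c.hist) (hs : c.Settled g o ts l) : c'.Settled g' o ts l := by
  intro y hy hlt
  rw [h.inv_eq _ _ _ ho] at hlt
  have := hc.inv_lt ho
  rcases h.pool_sub l y hy with hy | hy
  · obtain ⟨⟨v, st, hv, -⟩, -⟩ := hc.pool_mem l y hy
    rw [(h.heap_ext y v st hv).1] at hlt
    obtain ⟨v', b, e, hv', hts⟩ := hs y hy hlt
    obtain ⟨_, st', h1, h2⟩ := h.heap_ext y v' _ hv'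
    exact ⟨v', b, e, by rw [h1, h2 (by simp)], hts⟩
  · omega

/-- Emptiness at a past instant is never revoked: insertion and removal times already assigned are
fixed, and a new node is inserted after `k`. -/
theorem Ext.emptyAt (h : Ext i c g c' g') (hc : c.Inv g) {l k} (hk : k < c.clock)
    (hs : c.EmptyAt g l k) : c'.EmptyAt g' l k := by
  intro y x m hx hm
  rcases h.heap_new y x hx with ⟨v, st, hv⟩ | hy
  · have h1 := (h.heap_ext y v st hv).1
    obtain ⟨⟨t, ht⟩, -⟩ := hc.heap_ok y v st hv
    rcases h.hist_new _ hm with hm | hm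
    · rcases hs y _ m hv hm with h2 | ⟨o, h2, h3⟩
      · left; omega
      · obtain ⟨h4, h5⟩ := h.match_ext o y h2
        exact Or.inr ⟨o, h4, by omega⟩
    · have h2 := hc.inv_lt ht
      have h3 := h.inv_eq _ _ _ ht
      simp only [Event.time] at hm
      omega
  · left; omega

theorem Ext.retOK (h : Ext i c g c' g') (hc : c.Inv g) {t o k k' r} (hk : k ≤ c.clock)
    (hkk : k ≤ k') (hoi : o ≠ i) (hr : c.RetOK g t o k r) : c'.RetOK g' t o k' r := by
  cases r with
  | done =>
    obtain ⟨v, b, e, h1, h2, h3⟩ := hr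
    exact ⟨v, b, e, h.hist_sub _ h1, by rw [h.heap_eq _ hoi, h2], by omega⟩
  | val v =>
    obtain ⟨h1, a, st, h2, h3, h4⟩ := hr
    obtain ⟨h5, h6⟩ := h.match_ext o a h2
    obtain ⟨_, st', h7, _⟩ := h.heap_ext a v st h3
    exact ⟨h.hist_sub _ h1, a, st', h5, h7, by omega⟩
  | empty =>
    obtain ⟨h1, h2, k₀, h3, h4, h5⟩ := hr
    refine ⟨h.hist_sub _ h1, by rw [h.match_eq _ hoi, h2], k₀, ?_, by omega, fun l => ?_⟩
    · rwa [h.inv_eq _ _ _ h1]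
    · exact h.emptyAt hc (by omega) (h5 l)

theorem Ext.popOK (h : Ext i c g c' g') {t o} (hoi : o ≠ i) (hp : c.PopOK t o) :
    c'.PopOK t o :=
  ⟨h.hist_sub _ hp.1, by rw [h.match_eq _ hoi, hp.2]⟩

theorem Ext.startOK (h : Ext i c g c' g') {t o st} (hp : c.PopOK t o) (hs : StartOK g o st) :
    StartOK g' o st := by
  obtain ⟨b, e, h1, h2, h3⟩ := hs
  exact ⟨b, e, h1, by rwa [h.inv_eq _ _ _ hp.1], h3⟩

theorem Ext.candOK (h : Ext i c g c' g') {s : Scan n} (hs : c.CandOK s) : c'.CandOK s := by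
  refine ⟨hs.1, fun l a ha => ?_⟩
  obtain ⟨v, b, e, h1, h2⟩ := hs.2 l a ha
  obtain ⟨_, st', h3, h4⟩ := h.heap_ext a v _ h1
  exact ⟨v, b, e, by rw [h3, h4 (by simp)], h2⟩

/-- Every insertion raises the counter, so an unchanged counter leaves an empty list empty. -/
theorem Ext.topOK (h : Ext i c g c' g') {em l} (hs : c.TopOK em l) : c'.TopOK em l := by
  obtain ⟨k, h1, h2, h3⟩ := hs
  have := h.aba_le l
  refine ⟨k, h1, by omega, fun hk => ?_⟩
  rw [List.eq_nil_iff_forall_not_mem]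
  intro y hy
  rcases h.pool_sub l y hy with hy | hy
  · rw [h3 (by omega)] at hy
    simp at hy
  · omega

/-- Non-interference: each local assertion concerns shared data of its own operation, which `i` does
not touch, or facts that persist under `Ext`. -/
theorem Ext.locOK (h : Ext i c g c' g') (hc : c.Inv g) {t x} (hx : x.op ≠ some i)
    (hl : c.LocOK g t x) : c'.LocOK g' t x := by
  have hck := h.clock
  cases x <;> simp only [Local.op, ne_eq, Option.some.injEq] at hx <;> simp only [LocOK] at hl ⊢
  case pushInsert o v => exact ⟨h.hist_sub _ hl.1, by rw [h.heap_eq _ hx, hl.2]⟩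
  case pushBegin o =>
    obtain ⟨v, h1, h2⟩ := hl
    exact ⟨v, h.hist_sub _ h1, by rw [h.heap_eq _ hx, h2]⟩
  case pushStamp o b =>
    obtain ⟨v, h1, h2, h3, h4⟩ := hl
    exact ⟨v, h.hist_sub _ h1, by rw [h.heap_eq _ hx, h2],
      by rwa [(h.heap_ext _ _ _ h2).1], by omega⟩
  case pushSet o ts =>
    obtain ⟨v, b, e, h1, h2, h3, h4, h5, h6⟩ := hl
    exact ⟨v, b, e, h.hist_sub _ h1, by rw [h.heap_eq _ hx, h2], h3,
      by rwa [(h.heap_ext _ _ _ h2).1], h5, by omega⟩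
  case pushDone o => exact h.retOK hc le_rfl hck.le hx hl
  case popBegin o => exact h.popOK hx hl
  case popStamp o b =>
    exact ⟨h.popOK hx hl.1, by rw [h.inv_eq _ _ _ hl.1.1]; exact hl.2.1, by omega⟩
  case popLoop o st => exact ⟨h.popOK hx hl.1, h.startOK hl.1 hl.2⟩
  case scan o st s =>
    obtain ⟨h1, h2, h3, h4, h5⟩ := hl
    exact ⟨h.popOK hx h1, h.startOK h1 h2, fun l hl => h.settled hc h1.1 (h3 l hl), h.candOK h4,
      fun hs l hl => h.topOK (h5 hs l hl)⟩
  case readStamp o st s l a =>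
    obtain ⟨h1, h2, h3, h4, h5, v, sa, h6, h7, h8⟩ := hl
    obtain ⟨h9, sa', h10, _⟩ := h.heap_ext a v sa h6
    refine ⟨h.popOK hx h1, h.startOK h1 h2, fun l hl hne => h.settled hc h1.1 (h3 l hl hne),
      h.candOK h4, fun hs l hl hne => h.topOK (h5 hs l hl hne), v, sa', h10, h.hist_sub _ h7, ?_⟩
    intro y hy hlt
    rw [h.inv_eq _ _ _ h1.1] at hlt
    have := hc.inv_lt h1.1
    rcases h.pool_sub l y hy with hy | hy
    · obtain ⟨⟨v, st, hv, -⟩, -⟩ := hc.pool_mem l y hy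
      rw [(h.heap_ext y v st hv).1] at hlt ⊢
      rw [h9]
      exact h8 y hy hlt
    · omega
  case decide o st s =>
    obtain ⟨h1, h2, h3, h4, h5⟩ := hl
    exact ⟨h.popOK hx h1, h.startOK h1 h2, fun l => h.settled hc h1.1 (h3 l), h.candOK h4,
      fun hs l => h.topOK (h5 hs l)⟩
  case check o st em ch =>
    obtain ⟨h1, h2, k₀, h3, h4, h5, h6⟩ := hl
    refine ⟨h.popOK hx h1, h.startOK h1 h2, k₀, by rwa [h.inv_eq _ _ _ h1.1], by omega,
      fun l hl => h.emptyAt hc h4 (h5 l hl), fun l => ?_⟩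
    obtain ⟨k, h7, h8, h9⟩ := h6 l
    have := h.aba_le l
    exact ⟨k, h7, by omega, fun hk => h.emptyAt hc h4 (h9 (by omega))⟩
  case remove o st l a =>
    obtain ⟨h1, h2, h3⟩ := hl
    refine ⟨h.popOK hx h1, h.startOK h1 h2, ?_⟩
    have h8 := hc.inv_lt h1.1
    rcases h3 with h3 | ⟨v, b, e, h4, h5⟩
    -- If the push of `a` returns only in this step, its return time is later than the invocation of
    -- `o`.
    · left
      intro t' r hr
      rw [h.inv_eq _ _ _ h1.1]
      rcases h.hist_new _ hr with hr | hr
      · rw [h.ret_eq _ _ _ hr]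
        exact h3 t' r hr
      · simp only [Event.time] at hr
        omega
    · right
      obtain ⟨_, st', h6, h7⟩ := h.heap_ext a v _ h4
      exact ⟨v, b, e, by rw [h6, h7 (by simp)], fun l => h.settled hc h1.1 (h5 l)⟩
  case popDone o r => exact h.retOK hc le_rfl hck.le hx hl

end Frame

end Config

/-! ### Preservation of the invariant by each kind of step -/

namespace Config

variable {c : Config n V} {g : Ghost}

theorem Inv.init (n : ℕ) (V : Type u) (g : Ghost) : (Config.init n V).Inv g where
  time_lt := by simp [Config.init]
  sorted := by simp [Config.init]
  ret_ok := by simp [Config.init]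
  seq := by simp [Config.init]
  pending := by simp [Config.init]
  active := by simp [Config.init]
  heap_ok := by simp [Config.init]
  pool_mem := by simp [Config.init]
  pool_compl := by simp [Config.init]
  pool_sorted := by simp [Config.init]
  match_ok := by simp [Config.init]
  match_inj := by simp [Config.init]
  order := by simp [Config.init]
  loc_ok := by simp [Config.init, LocOK]

theorem Inv.exists_inv (h : c.Inv g) {t o} (ho : (c.loc t).op = some o) :
    ∃ m, Event.inv t m o ∈ c.hist :=
  (h.loc_ok t).exists_inv ho

theorem Inv.op_ne (h : c.Inv g) {t t' o} (ho : (c.loc t).op = some o) (ht : t' ≠ t) :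
    (c.loc t').op ≠ some o := by
  intro ho'
  obtain ⟨m, hm⟩ := h.exists_inv ho
  obtain ⟨m', hm'⟩ := h.exists_inv ho'
  exact ht (h.inv_unique hm' hm).1

/-- The local invariants of the other threads are stable. -/
theorem Inv.loc_ok_update (h : c.Inv g) {i t x} {c' : Config n V} {g' : Ghost}
    (hext : Ext i c g c' g') (hi : ∀ t', t' ≠ t → (c.loc t').op ≠ some i)
    (hloc : c'.loc = Function.update c.loc t x) (hx : c'.LocOK g' t x) :
    ∀ t, c'.LocOK g' t (c'.loc t) := by
  intro t'
  rw [hloc]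
  by_cases ht : t' = t
  · subst ht; simpa using hx
  · rw [Function.update_of_ne ht]
    exact hext.locOK h (hi t' ht) (h.loc_ok t')

/-- The `order` invariant is stable as long as no node is removed. -/
theorem Inv.order_update (h : c.Inv g) {i} {c' : Config n V} {g' : Ghost}
    (hext : Ext i c g c' g') (hm : c'.matching = c.matching) :
    ∀ o a t r, c'.matching o = some a → Event.ret t r a ∈ c'.hist → g'.ret a < g'.inv o →
    ∀ y x, c'.heap y = some x → g'.ins y < g'.inv o →
    (∀ o', c'.matching o' = some y → g'.rem a < g'.rem y) →
    ∃ b e, x.stamp = .call b e ∧ ∀ xa, c'.heap a = some xa → ¬ xa.stamp.Lt (.call b e) := by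
  intro o a t r ho hr hlt y x hx hy hrem
  rw [hm] at ho
  obtain ⟨⟨tₒ, hto⟩, ⟨⟨va, sa⟩, hxa⟩, -⟩ := h.match_ok o a ho
  have hio := hext.inv_eq _ _ _ hto
  have hioc := h.inv_lt hto
  -- A return of `a` or an insertion of `y` in the present step would be later than the invocation
  -- of `o`, against the hypotheses.
  rcases hext.hist_new _ hr with hr | hr
  swap
  · simp only [Event.time] at hr; omega
  rcases hext.heap_new y x hx with ⟨v, st, hv⟩ | hy'
  swap
  · omega
  obtain ⟨hins, st', hv', hst⟩ := hext.heap_ext y v st hv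
  obtain ⟨b, e, hb, hle⟩ := h.order o a t r ho hr (by rw [← hext.ret_eq _ _ _ hr, ← hio]; exact hlt)
    y _ hv (by omega) (by
      intro o' ho'
      have h1 := hrem o' (hm ▸ ho')
      rwa [(hext.match_ext o' y ho').2, (hext.match_ext o a ho).2] at h1)
  simp only at hb
  have hsb := hst (by rw [hb]; simp)
  refine ⟨b, e, ?_, ?_⟩
  · rw [hv'] at hx
    obtain rfl := Option.some.inj hx
    simp [hsb, hb]
  · intro xa hxa'
    have hle := hle _ hxa
    obtain ⟨-, st₂, hv₂, hst₂⟩ := hext.heap_ext a va sa hxa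
    rw [hv₂] at hxa'
    obtain rfl := Option.some.inj hxa'
    -- The push of `a` has returned, so its timestamp is final and the comparison with `y` cannot
    -- change.
    have hsa : sa ≠ .top := by
      rintro rfl
      obtain ⟨h1, -⟩ := h.ret_ok _ _ _ hr
      cases r with
      | done => obtain ⟨v, b, e, _, h2, _⟩ := h1; rw [h2] at hxa; simp at hxa
      | val v =>
        obtain ⟨⟨t', h3⟩, -⟩ := h.heap_ok _ _ _ hxa
        have := (h.inv_unique h1.1 h3).2
        simp at this
      | empty =>
        obtain ⟨⟨t', h3⟩, -⟩ := h.heap_ok _ _ _ hxa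
        have := (h.inv_unique h1.1 h3).2
        simp at this
    simpa [hst₂ hsa] using hle

/-- A step that only changes the local state. -/
theorem Inv.silent (h : c.Inv g) {t : Fin n} {x : Local n V} (hop : (c.loc t).op = x.op)
    (hx : (c.goto t x).LocOK g t x) {i : ℕ} (hi : (c.loc t).op = some i) :
    (c.goto t x).Inv g := by
  have hext : Ext i c g (c.goto t x) g :=
    { clock := by simp [goto]
      hist_sub := fun e he => he
      hist_new := fun e he => Or.inl he
      inv_eq := fun _ _ _ _ => rfl
      ret_eq := fun _ _ _ _ => rfl
      heap_eq := fun _ _ => rfl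
      heap_ext := fun y v st hv => ⟨rfl, st, hv, fun _ => rfl⟩
      heap_new := fun y x hx => Or.inl ⟨_, _, hx⟩
      pool_sub := fun l y hy => Or.inl hy
      aba_le := fun l => le_rfl
      match_eq := fun _ _ => rfl
      match_ext := fun o a ho => ⟨ho, rfl⟩ }
  have hlop : ∀ t', ((c.goto t x).loc t').op = (c.loc t').op := by
    intro t'
    simp only [goto, Function.update_apply]
    split
    · next h => subst h; exact hop.symm
    · rfl
  exact
  { time_lt := fun e he => (h.time_lt e he).trans hext.clock
    sorted := h.sorted
    ret_ok := h.ret_ok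
    seq := h.seq
    pending := fun t m o ho => by rw [hlop]; exact h.pending t m o ho
    active := fun t o ho => h.active t o (by rwa [hlop] at ho)
    heap_ok := fun y v st hy => by
      obtain ⟨h1, h2, h3, h4⟩ := h.heap_ok y v st hy
      have := hext.clock
      refine ⟨h1, h2, by omega, h4.imp_right ?_⟩
      rintro ⟨b, e, h5, h6, h7, h8⟩
      exact ⟨b, e, h5, h6, h7, by omega⟩
    pool_mem := h.pool_mem
    pool_compl := h.pool_compl
    pool_sorted := h.pool_sorted
    match_ok := fun o a ho => by
      obtain ⟨h1, h2, h3, h4, h5⟩ := h.match_ok o a ho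
      exact ⟨h1, h2, h3, h4, h5.trans hext.clock⟩
    match_inj := h.match_inj
    order := h.order
    loc_ok := h.loc_ok_update hext (fun t' ht => h.op_ne hi ht) rfl hx }

/-- The invocation of an operation. -/
theorem Inv.call (h : c.Inv g) {t : Fin n} {x : Local n V} {m : Method V} {o : ℕ}
    (hidle : c.loc t = .idle) (hfresh : ∀ e ∈ c.hist, e.op ≠ o) (hop : x.op = some o)
    (hx : c.heap o = none → c.matching o = none →
      ((c.emit (.inv t m o)).goto t x).LocOK { g with inv := Function.update g.inv o c.clock } t x) :
    ((c.emit (.inv t m o)).goto t x).Inv { g with inv := Function.update g.inv o c.clock } := by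
  set g' : Ghost := { g with inv := Function.update g.inv o c.clock } with hg'
  have hinv : ∀ q, q ≠ o → g'.inv q = g.inv q := fun q hq => Function.update_of_ne hq _ _
  have hinvo : g'.inv o = c.clock := Function.update_self _ _ _
  have hnew : ∀ e, e ∈ ((c.emit (.inv t m o)).goto t x).hist ↔ e ∈ c.hist ∨ e = .inv t m o := by
    intro e; simp [emit, goto]
  have htime : ∀ e ∈ c.hist, e.time g'.inv g'.ret = e.time g.inv g.ret := by
    intro e he
    have := hfresh e he
    cases e with
    | inv _ _ q => exact hinv q this
    | ret _ _ q => rfl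
  have hext : Ext o c g ((c.emit (.inv t m o)).goto t x) g' :=
    { clock := by simp [goto, emit]
      hist_sub := fun e he => (hnew e).2 (Or.inl he)
      hist_new := fun e he => by
        rcases (hnew e).1 he with he | rfl
        · exact Or.inl he
        · exact Or.inr hinvo.ge
      inv_eq := fun t m q hq => hinv q (hfresh _ hq)
      ret_eq := fun _ _ _ _ => rfl
      heap_eq := fun _ _ => rfl
      heap_ext := fun y v st hv => ⟨rfl, st, hv, fun _ => rfl⟩
      heap_new := fun y x hx => Or.inl ⟨_, _, hx⟩
      pool_sub := fun l y hy => Or.inl hy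
      aba_le := fun l => le_rfl
      match_eq := fun _ _ => rfl
      match_ext := fun o a ho => ⟨ho, rfl⟩ }
  have hlop : ∀ t' q, (c.loc t').op = some q → (((c.emit (.inv t m o)).goto t x).loc t').op = some q := by
    intro t' q hq
    simp only [goto, emit, Function.update_apply]
    split
    · next h => subst h; simp [hidle, Local.op] at hq
    · exact hq
  have hho : c.heap o = none := by
    by_contra hne
    obtain ⟨⟨v, st⟩, hy⟩ := Option.ne_none_iff_exists'.1 hne
    obtain ⟨⟨t', h1⟩, -⟩ := h.heap_ok _ _ _ hy
    exact hfresh _ h1 rfl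
  have hmo : c.matching o = none := by
    by_contra hne
    obtain ⟨a, hy⟩ := Option.ne_none_iff_exists'.1 hne
    obtain ⟨⟨t', h1⟩, -⟩ := h.match_ok _ _ hy
    exact hfresh _ h1 rfl
  have hact : ∀ t', (c.loc t').op ≠ some o := by
    intro t' ht'
    obtain ⟨m', hm'⟩ := h.exists_inv ht'
    exact hfresh _ hm' rfl
  exact
  { time_lt := fun e he => by
      have hc := hext.clock
      rcases (hnew e).1 he with he | rfl
      · rw [htime e he]; exact (h.time_lt e he).trans hc
      · exact hinvo.trans_lt hc
    sorted := by
      change (c.hist ++ [_]).Pairwise _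
      rw [List.pairwise_append]
      refine ⟨h.sorted.imp_of_mem fun ha hb hab => by rwa [htime _ ha, htime _ hb], by simp, ?_⟩
      intro e he e' he'
      obtain rfl := List.mem_singleton.1 he'
      rw [htime e he]
      exact (h.time_lt e he).trans_eq hinvo.symm
    ret_ok := fun t' r q hq => by
      rcases (hnew _).1 hq with hq | hq
      · obtain ⟨h1, h2⟩ := h.ret_ok _ _ _ hq
        refine ⟨hext.retOK h (h.time_lt _ hq).le le_rfl (hfresh _ hq) h1, ?_⟩
        rw [hinv q (hfresh _ hq)]
        exact h2
      · simp at hq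
    seq := fun t' m₁ m₂ o₁ o₂ h1 h2 hlt => by
      rcases (hnew _).1 h1 with k1 | k1
      · rw [hinv o₁ (hfresh _ k1)] at hlt
        rcases (hnew _).1 h2 with k2 | k2
        · rw [hinv o₂ (hfresh _ k2)] at hlt ⊢
          obtain ⟨r, h3, h4⟩ := h.seq _ _ _ _ _ k1 k2 hlt
          exact ⟨r, hext.hist_sub _ h3, h4⟩
        · simp only [Event.inv.injEq] at k2
          obtain ⟨rfl, rfl, rfl⟩ := k2
          -- The thread is idle, so its earlier operation cannot be pending.
          rcases h.pending _ _ _ k1 with ⟨r, h3⟩ | h3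
          · exact ⟨r, hext.hist_sub _ h3, (h.time_lt _ h3).trans_eq hinvo.symm⟩
          · simp [hidle, Local.op] at h3
      · simp only [Event.inv.injEq] at k1
        obtain ⟨rfl, rfl, rfl⟩ := k1
        rw [hinvo] at hlt
        rcases (hnew _).1 h2 with k2 | k2
        · rw [hinv o₂ (hfresh _ k2)] at hlt
          have := h.inv_lt k2
          omega
        · simp only [Event.inv.injEq] at k2
          rw [k2.2.2, hinvo] at hlt
          omega
    pending := fun t' m' q hq => by
      rcases (hnew _).1 hq with hq | hq
      · rcases h.pending _ _ _ hq with ⟨r, h3⟩ | h3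
        · exact Or.inl ⟨r, hext.hist_sub _ h3⟩
        · exact Or.inr (hlop _ _ h3)
      · simp only [Event.inv.injEq] at hq
        obtain ⟨rfl, rfl, rfl⟩ := hq
        right
        simp [goto, hop]
    active := fun t' q hq t₂ r hr => by
      rcases (hnew _).1 hr with hr | hr
      · simp only [goto, emit, Function.update_apply] at hq
        split at hq
        · rw [hop] at hq
          exact hfresh _ hr (Option.some.inj hq).symm
        · exact h.active t' q hq t₂ r hr
      · simp at hr
    heap_ok := fun y v st hy => by
      obtain ⟨⟨t', h1⟩, h2, h3, h4⟩ := h.heap_ok y v st hy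
      have := hext.clock
      refine ⟨⟨t', hext.hist_sub _ h1⟩, ?_, h3.trans hext.clock, h4.imp_right ?_⟩
      · rw [hinv y (hfresh _ h1)]; exact h2
      rintro ⟨b, e, h5, h6, h7, h8⟩
      exact ⟨b, e, h5, h6, h7, by omega⟩
    pool_mem := fun l y hy => by
      obtain ⟨⟨v, st, h1, h2⟩, h3⟩ := h.pool_mem l y hy
      exact ⟨⟨v, st, h1, hext.hist_sub _ h2⟩, h3⟩
    pool_compl := fun l m' y x hy hm hno => by
      rcases (hnew _).1 hm with hm | hm
      · exact h.pool_compl l m' y x hy hm hno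
      · simp only [Event.inv.injEq] at hm
        obtain ⟨rfl, rfl, rfl⟩ := hm
        exact absurd (hho.symm.trans hy) (by simp)
    pool_sorted := h.pool_sorted
    match_ok := fun q a hq => by
      obtain ⟨⟨t', h1⟩, h2, h3, h4, h5⟩ := h.match_ok q a hq
      refine ⟨⟨t', hext.hist_sub _ h1⟩, h2, h3, ?_, h5.trans hext.clock⟩
      rw [hinv q (hfresh _ h1)]
      exact h4
    match_inj := h.match_inj
    order := h.order_update hext rfl
    loc_ok := h.loc_ok_update hext (fun t' _ => hact t') rfl (hx hho hmo) }

/-- The return of an operation. -/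
theorem Inv.return (h : c.Inv g) {t : Fin n} {r : Ret V} {o : ℕ}
    (hop : (c.loc t).op = some o) (hr : c.RetOK g t o c.clock r) :
    ((c.emit (.ret t r o)).goto t .idle).Inv
      { g with ret := Function.update g.ret o c.clock } := by
  set g' : Ghost := { g with ret := Function.update g.ret o c.clock } with hg'
  have hret : ∀ q, q ≠ o → g'.ret q = g.ret q := fun q hq => Function.update_of_ne hq _ _
  have hreto : g'.ret o = c.clock := Function.update_self _ _ _
  have hnew : ∀ e, e ∈ ((c.emit (.ret t r o)).goto t .idle).hist ↔
      e ∈ c.hist ∨ e = .ret t r o := by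
    intro e; simp [emit, goto]
  have hne : ∀ t' r' q, Event.ret t' r' q ∈ c.hist → q ≠ o := by
    rintro t' r' q hq rfl
    exact h.active t _ hop _ _ hq
  have htime : ∀ e ∈ c.hist, e.time g'.inv g'.ret = e.time g.inv g.ret := by
    intro e he
    cases e with
    | inv _ _ q => rfl
    | ret _ _ q => exact hret q (hne _ _ _ he)
  -- A return changes neither heap nor matching, so the frame relation holds for every `i`. For the
  -- returning operation `q` itself it is used with `i = q + 1`, since `Ext.retOK` requires `i ≠ q`.
  have hext : ∀ i, Ext i c g ((c.emit (.ret t r o)).goto t .idle) g' := fun i =>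
    { clock := by simp [goto, emit]
      hist_sub := fun e he => (hnew e).2 (Or.inl he)
      hist_new := fun e he => by
        rcases (hnew e).1 he with he | rfl
        · exact Or.inl he
        · exact Or.inr hreto.ge
      inv_eq := fun t m q hq => rfl
      ret_eq := fun t r q hq => hret q (hne _ _ _ hq)
      heap_eq := fun _ _ => rfl
      heap_ext := fun y v st hv => ⟨rfl, st, hv, fun _ => rfl⟩
      heap_new := fun y x hx => Or.inl ⟨_, _, hx⟩
      pool_sub := fun l y hy => Or.inl hy
      aba_le := fun l => le_rfl
      match_eq := fun _ _ => rfl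
      match_ext := fun o a ho => ⟨ho, rfl⟩ }
  obtain ⟨m, hm⟩ := h.exists_inv hop
  exact
  { time_lt := fun e he => by
      have hc := (hext o).clock
      rcases (hnew e).1 he with he | rfl
      · rw [htime e he]; exact (h.time_lt e he).trans hc
      · exact hreto.trans_lt hc
    sorted := by
      change (c.hist ++ [_]).Pairwise _
      rw [List.pairwise_append]
      refine ⟨h.sorted.imp_of_mem fun ha hb hab => by rwa [htime _ ha, htime _ hb], by simp, ?_⟩
      intro e he e' he'
      obtain rfl := List.mem_singleton.1 he'
      rw [htime e he]
      exact (h.time_lt e he).trans_eq hreto.symm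
    ret_ok := fun t' r' q hq => by
      rcases (hnew _).1 hq with hq | hq
      · obtain ⟨h1, h2⟩ := h.ret_ok _ _ _ hq
        have h3 := hne _ _ _ hq
        rw [hret q h3]
        exact ⟨(hext o).retOK h (h.time_lt _ hq).le le_rfl h3 h1, h2⟩
      · simp only [Event.ret.injEq] at hq
        obtain ⟨rfl, rfl, rfl⟩ := hq
        rw [hreto]
        exact ⟨(hext (q + 1)).retOK h le_rfl le_rfl (by omega) hr, h.inv_lt hm⟩
    seq := fun t' m₁ m₂ o₁ o₂ h1 h2 hlt => by
      rcases (hnew _).1 h1 with h1 | h1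
      · rcases (hnew _).1 h2 with h2 | h2
        · obtain ⟨r', h3, h4⟩ := h.seq _ _ _ _ _ h1 h2 hlt
          exact ⟨r', (hext o).hist_sub _ h3, by rwa [hret _ (hne _ _ _ h3)]⟩
        · simp at h2
      · simp at h1
    pending := fun t' m' q hq => by
      rcases (hnew _).1 hq with hq | hq
      · rcases h.pending _ _ _ hq with ⟨r', h3⟩ | h3
        · exact Or.inl ⟨r', (hext o).hist_sub _ h3⟩
        · by_cases ht : t' = t
          · subst ht
            rw [hop] at h3
            obtain rfl := Option.some.inj h3
            exact Or.inl ⟨r, (hnew _).2 (Or.inr rfl)⟩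
          · right
            simpa [goto, emit, ht] using h3
      · simp at hq
    active := fun t' q hq t₂ r' hr' => by
      simp only [goto, emit, Function.update_apply] at hq
      split at hq
      · simp [Local.op] at hq
      · next ht =>
        rcases (hnew _).1 hr' with hr' | hr'
        · exact h.active t' q hq t₂ r' hr'
        · simp only [Event.ret.injEq] at hr'
          obtain ⟨rfl, rfl, rfl⟩ := hr'
          exact h.op_ne hop ht hq
    heap_ok := fun y v st hy => by
      obtain ⟨⟨t', h1⟩, h2, h3, h4⟩ := h.heap_ok y v st hy
      have := (hext o).clock
      refine ⟨⟨t', (hext o).hist_sub _ h1⟩, h2, h3.trans (hext o).clock, h4.imp_right ?_⟩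
      rintro ⟨b, e, h5, h6, h7, h8⟩
      exact ⟨b, e, h5, h6, h7, by omega⟩
    pool_mem := fun l y hy => by
      obtain ⟨⟨v, st, h1, h2⟩, h3⟩ := h.pool_mem l y hy
      exact ⟨⟨v, st, h1, (hext o).hist_sub _ h2⟩, h3⟩
    pool_compl := fun l m' y x hy hm hno => by
      rcases (hnew _).1 hm with hm | hm
      · exact h.pool_compl l m' y x hy hm hno
      · simp at hm
    pool_sorted := h.pool_sorted
    match_ok := fun q a hq => by
      obtain ⟨⟨t', h1⟩, h2, h3, h4, h5⟩ := h.match_ok q a hq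
      exact ⟨⟨t', (hext o).hist_sub _ h1⟩, h2, h3, h4, h5.trans (hext o).clock⟩
    match_inj := h.match_inj
    order := h.order_update (hext o) rfl
    loc_ok := h.loc_ok_update (hext o) (fun t' ht => h.op_ne hop ht) rfl trivial }

theorem Inv.not_matched_of_push (h : c.Inv g) {t v o} (ho : Event.inv t (.push v) o ∈ c.hist) :
    c.matching o = none := by
  by_contra hne
  obtain ⟨a, hy⟩ := Option.ne_none_iff_exists'.1 hne
  obtain ⟨⟨t', h1⟩, -⟩ := h.match_ok _ _ hy
  have := (h.inv_unique ho h1).2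
  simp at this

/-- Insertion of a node into a list. -/
theorem Inv.insert (h : c.Inv g) {t : Fin n} {o : ℕ} {v : V} (hloc : c.loc t = .pushInsert o v) :
    (((c.setNode o ⟨v, .top⟩).setPool t ((c.pool t).insert o)).goto t (.pushBegin o)).Inv
      { g with ins := Function.update g.ins o c.clock } := by
  set g' : Ghost := { g with ins := Function.update g.ins o c.clock } with hg'
  set c' := ((c.setNode o ⟨v, .top⟩).setPool t ((c.pool t).insert o)).goto t (.pushBegin o)
    with hc'
  have hop : (c.loc t).op = some o := by rw [hloc]; rfl
  have hl := h.loc_ok t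
  rw [hloc] at hl
  obtain ⟨hinv, hnone⟩ := hl
  have hins : ∀ q, q ≠ o → g'.ins q = g.ins q := fun q hq => Function.update_of_ne hq _ _
  have hinso : g'.ins o = c.clock := Function.update_self _ _ _
  have hheap : ∀ q, q ≠ o → c'.heap q = c.heap q := fun q hq => Function.update_of_ne hq _ _
  have hheapo : c'.heap o = some ⟨v, .top⟩ := Function.update_self _ _ _
  have hpool : ∀ l, l ≠ t → c'.pool l = c.pool l := fun q hq => Function.update_of_ne hq _ _
  have hpoolt : c'.pool t = ⟨o :: (c.pool t).nodes, (c.pool t).aba + 1⟩ :=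
    Function.update_self _ _ _
  have hne : ∀ y x, c.heap y = some x → y ≠ o := by
    rintro y x hy rfl
    rw [hnone] at hy
    simp at hy
  have hpne : ∀ l, ∀ y ∈ (c.pool l).nodes, y ≠ o := by
    intro l y hy
    obtain ⟨⟨v, st, h1, _⟩, _⟩ := h.pool_mem l y hy
    exact hne _ _ h1
  have hmo : ∀ q, c.matching q ≠ some o := by
    intro q hq
    obtain ⟨-, ⟨x, hx⟩, -⟩ := h.match_ok q o hq
    exact hne _ _ hx rfl
  have hext : Ext o c g c' g' :=
    { clock := by simp [hc', goto, setPool, setNode]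
      hist_sub := fun e he => he
      hist_new := fun e he => Or.inl he
      inv_eq := fun _ _ _ _ => rfl
      ret_eq := fun _ _ _ _ => rfl
      heap_eq := hheap
      heap_ext := fun y v st hv => ⟨hins y (hne _ _ hv), st, by rw [hheap y (hne _ _ hv), hv],
        fun _ => rfl⟩
      heap_new := fun y x hx => by
        by_cases hy : y = o
        · subst hy; exact Or.inr hinso.ge
        · rw [hheap y hy] at hx
          exact Or.inl ⟨_, _, hx⟩
      pool_sub := fun l y hy => by
        by_cases hlt : l = t
        · subst hlt
          rw [hpoolt] at hy ⊢
          rcases List.mem_cons.1 hy with rfl | hy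
          · exact Or.inr ⟨hinso.ge, by simp⟩
          · exact Or.inl hy
        · rw [hpool l hlt] at hy
          exact Or.inl hy
      aba_le := fun l => by
        by_cases hlt : l = t
        · subst hlt; rw [hpoolt]; simp
        · rw [hpool l hlt]
      match_eq := fun _ _ => rfl
      match_ext := fun o a ho => ⟨ho, rfl⟩ }
  have hck := hext.clock
  have hlop : ∀ t', (c'.loc t').op = (c.loc t').op := by
    intro t'
    simp only [hc', goto, setPool, setNode, Function.update_apply]
    split
    · next h => subst h; exact hop.symm
    · rfl
  exact
  { time_lt := fun e he => (h.time_lt e he).trans hck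
    sorted := h.sorted
    ret_ok := fun t' r q hq => by
      obtain ⟨h1, h2⟩ := h.ret_ok _ _ _ hq
      exact ⟨hext.retOK h (h.time_lt _ hq).le le_rfl
        (fun hqo => h.active t o hop _ _ (hqo ▸ hq)) h1, h2⟩
    seq := h.seq
    pending := fun t m o ho => by rw [hlop]; exact h.pending t m o ho
    active := fun t o ho => h.active t o (by rwa [hlop] at ho)
    heap_ok := fun y w st hy => by
      by_cases hyo : y = o
      · subst hyo
        rw [hheapo] at hy
        simp only [Option.some.injEq, Node.mk.injEq] at hy
        obtain ⟨rfl, rfl⟩ := hy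
        rw [hinso]
        exact ⟨⟨t, hinv⟩, h.inv_lt hinv, hck, Or.inl rfl⟩
      · rw [hheap y hyo] at hy
        obtain ⟨h1, h2, h3, h4⟩ := h.heap_ok y w st hy
        rw [hins y hyo]
        refine ⟨h1, h2, by omega, h4.imp_right ?_⟩
        rintro ⟨b, e, h5, h6, h7, h8⟩
        exact ⟨b, e, h5, h6, h7, by omega⟩
    pool_mem := fun l y hy => by
      by_cases hyo : y = o
      · subst hyo
        refine ⟨⟨v, _, hheapo, ?_⟩, hmo⟩
        by_cases hlt : l = t
        · rwa [hlt]
        · rw [hpool l hlt] at hy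
          exact absurd rfl (hpne l _ hy)
      · rw [hheap y hyo]
        refine h.pool_mem l y ?_
        by_cases hlt : l = t
        · subst hlt
          rw [hpoolt] at hy
          exact (List.mem_cons.1 hy).resolve_left hyo
        · rwa [hpool l hlt] at hy
    pool_compl := fun l m y x hy hm hno => by
      by_cases hyo : y = o
      · subst hyo
        obtain ⟨rfl, -⟩ := h.inv_unique hinv hm
        rw [hpoolt]
        simp
      · rw [hheap y hyo] at hy
        have := h.pool_compl l m y x hy hm hno
        by_cases hlt : l = t
        · subst hlt
          rw [hpoolt]
          exact List.mem_cons_of_mem _ this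
        · rwa [hpool l hlt]
    pool_sorted := fun l => by
      have h1 : (c.pool l).nodes.Pairwise fun y z => g'.ins z < g'.ins y :=
        (h.pool_sorted l).imp_of_mem fun ha hb hab => by
          rwa [hins _ (hpne l _ ha), hins _ (hpne l _ hb)]
      by_cases hlt : l = t
      · subst hlt
        rw [hpoolt]
        refine List.pairwise_cons.2 ⟨fun y hy => ?_, h1⟩
        obtain ⟨⟨v, st, h2, _⟩, _⟩ := h.pool_mem l y hy
        rw [hinso, hins y (hpne l y hy)]
        exact (h.heap_ok _ _ _ h2).2.2.1
      · rwa [hpool l hlt]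
    match_ok := fun q a hq => by
      obtain ⟨h1, ⟨x, h2⟩, h3, h4, h5⟩ := h.match_ok q a hq
      have h6 := hne _ _ h2
      refine ⟨h1, ⟨x, by rw [hheap a h6, h2]⟩, by rw [hins a h6]; exact h3, h4, h5.trans hck⟩
    match_inj := h.match_inj
    order := h.order_update hext rfl
    loc_ok := h.loc_ok_update hext (fun t' ht => h.op_ne hop ht) rfl ⟨v, hinv, hheapo⟩ }

/-- Assignment of the generated timestamp to a node. -/
theorem Inv.setStamp (h : c.Inv g) {t : Fin n} {o : ℕ} {ts : Stamp} {x : Node V}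
    (hloc : c.loc t = .pushSet o ts) (hx : c.heap o = some x) :
    ((c.setNode o ⟨x.val, ts⟩).goto t (.pushDone o)).Inv g := by
  set c' := (c.setNode o ⟨x.val, ts⟩).goto t (.pushDone o) with hc'
  have hop : (c.loc t).op = some o := by rw [hloc]; rfl
  have hl := h.loc_ok t
  rw [hloc] at hl
  obtain ⟨v, b, e, hinv, hxo, rfl, hib, hbe, hek⟩ := hl
  obtain rfl := Option.some.inj (hx.symm.trans hxo)
  have hheap : ∀ q, q ≠ o → c'.heap q = c.heap q := fun q hq => Function.update_of_ne hq _ _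
  have hheapo : c'.heap o = some ⟨v, .call b e⟩ := Function.update_self _ _ _
  have hiff : ∀ y, (∃ x, c'.heap y = some x) ↔ ∃ x, c.heap y = some x := by
    intro y
    by_cases hy : y = o
    · subst hy; simp [hheapo, hx]
    · rw [hheap y hy]
  have hext : Ext o c g c' g :=
    { clock := by simp [hc', goto, setNode]
      hist_sub := fun e he => he
      hist_new := fun e he => Or.inl he
      inv_eq := fun _ _ _ _ => rfl
      ret_eq := fun _ _ _ _ => rfl
      heap_eq := hheap
      heap_ext := fun y w st hy => by
        refine ⟨rfl, ?_⟩
        by_cases hyo : y = o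
        · subst hyo
          rw [hx] at hy
          simp only [Option.some.injEq, Node.mk.injEq] at hy
          obtain ⟨rfl, rfl⟩ := hy
          exact ⟨_, hheapo, by simp⟩
        · exact ⟨st, by rw [hheap y hyo, hy], fun _ => rfl⟩
      heap_new := fun y x hy => by
        obtain ⟨x', hx'⟩ := (hiff y).1 ⟨x, hy⟩
        exact Or.inl ⟨_, _, hx'⟩
      pool_sub := fun l y hy => Or.inl hy
      aba_le := fun l => le_rfl
      match_eq := fun _ _ => rfl
      match_ext := fun o a ho => ⟨ho, rfl⟩ }
  have hck := hext.clock
  have hlop : ∀ t', (c'.loc t').op = (c.loc t').op := by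
    intro t'
    simp only [hc', goto, setNode, Function.update_apply]
    split
    · next h => subst h; exact hop.symm
    · rfl
  exact
  { time_lt := fun e he => (h.time_lt e he).trans hck
    sorted := h.sorted
    ret_ok := fun t' r q hq => by
      obtain ⟨h1, h2⟩ := h.ret_ok _ _ _ hq
      exact ⟨hext.retOK h (h.time_lt _ hq).le le_rfl
        (fun hqo => h.active t o hop _ _ (hqo ▸ hq)) h1, h2⟩
    seq := h.seq
    pending := fun t m o ho => by rw [hlop]; exact h.pending t m o ho
    active := fun t o ho => h.active t o (by rwa [hlop] at ho)
    heap_ok := fun y w st hy => by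
      by_cases hyo : y = o
      · subst hyo
        rw [hheapo] at hy
        simp only [Option.some.injEq, Node.mk.injEq] at hy
        obtain ⟨rfl, rfl⟩ := hy
        obtain ⟨h1, h2, h3, -⟩ := h.heap_ok _ _ _ hx
        exact ⟨h1, h2, by omega, Or.inr ⟨b, e, rfl, hib, hbe, by omega⟩⟩
      · rw [hheap y hyo] at hy
        obtain ⟨h1, h2, h3, h4⟩ := h.heap_ok y w st hy
        refine ⟨h1, h2, by omega, h4.imp_right ?_⟩
        rintro ⟨b, e, h5, h6, h7, h8⟩
        exact ⟨b, e, h5, h6, h7, by omega⟩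
    pool_mem := fun l y hy => by
      obtain ⟨⟨w, st, h1, h2⟩, h3⟩ := h.pool_mem l y hy
      obtain ⟨-, st', h4, -⟩ := hext.heap_ext _ _ _ h1
      exact ⟨⟨w, st', h4, h2⟩, h3⟩
    pool_compl := fun l m y x hy hm hno => by
      obtain ⟨x', hx'⟩ := (hiff y).1 ⟨x, hy⟩
      exact h.pool_compl l m y x' hx' hm hno
    pool_sorted := h.pool_sorted
    match_ok := fun q a hq => by
      obtain ⟨h1, h2, h3, h4, h5⟩ := h.match_ok q a hq
      exact ⟨h1, (hiff a).2 h2, h3, h4, h5.trans hck⟩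
    match_inj := h.match_inj
    order := h.order_update hext rfl
    loc_ok := h.loc_ok_update hext (fun t' ht => h.op_ne hop ht) rfl
      ⟨v, b, e, hinv, hheapo, hek.trans hck⟩ }

/-- Removal of a node. -/
theorem Inv.remove (h : c.Inv g) {t : Fin n} {o : ℕ} {st : Stamp} {l : Fin n} {a : ℕ}
    {x : Node V} (hloc : c.loc t = .remove o st l a) (ha : a ∈ (c.pool l).nodes)
    (hx : c.heap a = some x) :
    (((c.setPool l ((c.pool l).remove a)).setMatching o a).goto t (.popDone o (.val x.val))).Inv
      { g with rem := Function.update g.rem a c.clock } := by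
  set g' : Ghost := { g with rem := Function.update g.rem a c.clock } with hg'
  set c' := ((c.setPool l ((c.pool l).remove a)).setMatching o a).goto t
    (.popDone o (.val x.val)) with hc'
  have hop : (c.loc t).op = some o := by rw [hloc]; rfl
  have hl := h.loc_ok t
  rw [hloc] at hl
  obtain ⟨⟨hinv, hmo⟩, -, hcase⟩ := hl
  have hrem : ∀ q, q ≠ a → g'.rem q = g.rem q := fun q hq => Function.update_of_ne hq _ _
  have hrema : g'.rem a = c.clock := Function.update_self _ _ _
  have hmat : ∀ q, q ≠ o → c'.matching q = c.matching q := fun q hq =>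
    Function.update_of_ne hq _ _
  have hmato : c'.matching o = some a := Function.update_self _ _ _
  have hpool : ∀ q, q ≠ l → c'.pool q = c.pool q := fun q hq => Function.update_of_ne hq _ _
  have hpooll : c'.pool l = ⟨(c.pool l).nodes.erase a, (c.pool l).aba⟩ :=
    Function.update_self _ _ _
  obtain ⟨⟨va, sa, hva, hinva⟩, hnoa⟩ := h.pool_mem l a ha
  have hmne : ∀ q b, c.matching q = some b → q ≠ o ∧ b ≠ a := by
    intro q b hq
    refine ⟨?_, ?_⟩
    · rintro rfl; rw [hmo] at hq; simp at hq
    · rintro rfl; exact hnoa q hq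
  have hnodup : (c.pool l).nodes.Nodup := (h.pool_sorted l).imp fun hab => by
    rintro rfl; omega
  have hsub : ∀ q, (c'.pool q).nodes.Sublist (c.pool q).nodes := by
    intro q
    by_cases hq : q = l
    · subst hq; rw [hpooll]; exact List.erase_sublist
    · rw [hpool q hq]
  have hext : Ext o c g c' g' :=
    { clock := by simp [hc', goto, setPool, setMatching]
      hist_sub := fun e he => he
      hist_new := fun e he => Or.inl he
      inv_eq := fun _ _ _ _ => rfl
      ret_eq := fun _ _ _ _ => rfl
      heap_eq := fun _ _ => rfl
      heap_ext := fun y w st hy => ⟨rfl, st, hy, fun _ => rfl⟩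
      heap_new := fun y x hx => Or.inl ⟨_, _, hx⟩
      pool_sub := fun q y hy => Or.inl ((hsub q).subset hy)
      aba_le := fun q => by
        by_cases hq : q = l
        · subst hq; rw [hpooll]
        · rw [hpool q hq]
      match_eq := hmat
      match_ext := fun q b hq => by
        obtain ⟨h1, h2⟩ := hmne q b hq
        exact ⟨by rw [hmat q h1, hq], hrem b h2⟩ }
  have hck := hext.clock
  have hlop : ∀ t', (c'.loc t').op = (c.loc t').op := by
    intro t'
    simp only [hc', goto, setPool, setMatching, Function.update_apply]
    split
    · next h => subst h; exact hop.symm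
    · rfl
  have hmat' : ∀ q b, c'.matching q = some b →
      (q = o ∧ b = a) ∨ (q ≠ o ∧ b ≠ a ∧ c.matching q = some b) := by
    intro q b hq
    by_cases hqo : q = o
    · subst hqo
      rw [hmato] at hq
      exact Or.inl ⟨rfl, (Option.some.inj hq).symm⟩
    · rw [hmat q hqo] at hq
      exact Or.inr ⟨hqo, (hmne q b hq).2, hq⟩
  exact
  { time_lt := fun e he => (h.time_lt e he).trans hck
    sorted := h.sorted
    ret_ok := fun t' r q hq => by
      obtain ⟨h1, h2⟩ := h.ret_ok _ _ _ hq
      exact ⟨hext.retOK h (h.time_lt _ hq).le le_rfl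
        (fun hqo => h.active t o hop _ _ (hqo ▸ hq)) h1, h2⟩
    seq := h.seq
    pending := fun t m o ho => by rw [hlop]; exact h.pending t m o ho
    active := fun t o ho => h.active t o (by rwa [hlop] at ho)
    heap_ok := fun y w st hy => by
      obtain ⟨h1, h2, h3, h4⟩ := h.heap_ok y w st hy
      refine ⟨h1, h2, h3.trans hck, h4.imp_right ?_⟩
      rintro ⟨b, e, h5, h6, h7, h8⟩
      exact ⟨b, e, h5, h6, h7, by omega⟩
    pool_mem := fun q y hy => by
      obtain ⟨h1, h2⟩ := h.pool_mem q y ((hsub q).subset hy)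
      refine ⟨h1, fun p hp => ?_⟩
      rcases hmat' p y hp with ⟨rfl, rfl⟩ | ⟨_, _, hp⟩
      · obtain ⟨v, st, h3, h4⟩ := h1
        obtain ⟨rfl, -⟩ := h.inv_unique h4 hinva
        rw [hpooll] at hy
        exact hnodup.not_mem_erase hy
      · exact h2 p hp
    pool_compl := fun q m y z hy hm hno => by
      have hya : y ≠ a := by rintro rfl; exact hno o hmato
      have h1 := h.pool_compl q m y z hy hm fun p hp => hno p (hext.match_ext p y hp).1
      by_cases hq : q = l
      · subst hq
        rw [hpooll]
        exact (List.mem_erase_of_ne hya).2 h1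
      · rwa [hpool q hq]
    pool_sorted := fun q => (h.pool_sorted q).sublist (hsub q)
    match_ok := fun q b hq => by
      rcases hmat' q b hq with ⟨rfl, rfl⟩ | ⟨_, hb, hq⟩
      · rw [hrema]
        exact ⟨⟨t, hinv⟩, ⟨x, hx⟩, (h.heap_ok _ _ _ hva).2.2.1, h.inv_lt hinv, hck⟩
      · obtain ⟨h1, h2, h3, h4, h5⟩ := h.match_ok q b hq
        rw [hrem b hb]
        exact ⟨h1, h2, h3, h4, h5.trans hck⟩
    match_inj := fun q q' b hq hq' => by
      rcases hmat' q b hq with ⟨rfl, rfl⟩ | ⟨_, hb, hq⟩ <;>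
        rcases hmat' q' b hq' with ⟨h1, h2⟩ | ⟨_, hb', hq'⟩
      · exact h1.symm
      · exact absurd rfl hb'
      · exact absurd h2 hb
      · exact h.match_inj q q' b hq hq'
    order := fun q b t' r hq hr hlt y z hy hyi hno => by
      rcases hmat' q b hq with ⟨rfl, rfl⟩ | ⟨_, hb, hq⟩
      -- For the new pair, an elimination contradicts the return of the push before the pop. In the
      -- candidate case `y` is still stored, since a removal of `y` would be earlier than the
      -- present one; so the bound collected in the traversal applies to `y`.
      · rcases hcase with hcase | ⟨v, bs, es, h1, h2⟩
        · have := hcase _ _ hr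
          change g.ret b < g.inv q at hlt
          omega
        · have h3 : ∀ p, c.matching p ≠ some y := by
            intro p hp
            have h4 := hno p (hext.match_ext p y hp).1
            rw [hrema, hrem y (hmne p y hp).2] at h4
            have := (h.match_ok p y hp).2.2.2.2
            omega
          obtain ⟨⟨t₁, h4⟩, -⟩ := h.heap_ok y z.val z.stamp hy
          have h5 := h.pool_compl _ _ _ _ hy h4 h3
          obtain ⟨w, b', e', h6, h7⟩ := h2 _ y h5 hyi
          have h8 := Option.some.inj (hy.symm.trans h6)
          refine ⟨b', e', by rw [h8], fun xa hxa => ?_⟩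
          have h9 := Option.some.inj (h1.symm.trans hxa)
          rw [← h9]
          exact h7
      · refine h.order q b t' r hq hr hlt y z hy hyi fun p hp => ?_
        have h1 := hno p (hext.match_ext p y hp).1
        rwa [hrem b hb, hrem y (hmne p y hp).2] at h1
    loc_ok := h.loc_ok_update hext (fun t' ht => h.op_ne hop ht) rfl
      ⟨hinv, a, x.stamp, hmato, hx, by rw [hrema]; exact hck⟩ }

end Config

/-- Chaining "ends before the next begins" needs the middle interval to be well formed, `b ≤ e`. -/
theorem Stamp.Lt.trans {x y z : Stamp} (hy : ∀ b e, y = .call b e → b ≤ e) (h : x.Lt y)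
    (h' : y.Lt z) : x.Lt z := by
  cases x <;> cases y <;> cases z <;> simp_all [Stamp.Lt]
  omega

/-! ### Timestamps in the traversal, and the induction over executions -/

namespace Config

variable {c : Config n V} {g : Ghost}

/-- Nodes of the same list are stamped in the order of their insertion. -/
theorem Inv.stamp_lt_of_ins_lt (h : c.Inv g) {l m m' y a x x'} (hy : c.heap y = some x)
    (hyl : Event.inv l m y ∈ c.hist) (ha : c.heap a = some x') (hal : Event.inv l m' a ∈ c.hist)
    (hlt : g.ins y < g.ins a) :
    ∃ v b e, c.heap y = some ⟨v, .call b e⟩ ∧ b < e ∧ e < g.ins a := by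
  have hpush : ∀ y x t r, c.heap y = some x → Event.ret t r y ∈ c.hist →
      ∃ v b e, c.heap y = some ⟨v, .call b e⟩ ∧ g.ins y < b ∧ b < e ∧ e < g.ret y := by
    intro y x t r hy hr
    obtain ⟨⟨t', h1⟩, -⟩ := h.heap_ok y x.val x.stamp hy
    obtain ⟨h2, -⟩ := h.ret_ok _ _ _ hr
    cases r with
    | done =>
      obtain ⟨v, b, e, -, h3, h4⟩ := h2
      obtain ⟨-, -, -, h5⟩ := h.heap_ok _ _ _ h3
      simp only [reduceCtorEq, Stamp.call.injEq, false_or] at h5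
      obtain ⟨_, _, ⟨rfl, rfl⟩, h6, h7, _⟩ := h5
      exact ⟨v, b, e, h3, h6, h7, h4⟩
    | val v => simpa using (h.inv_unique h1 h2.1).2
    | empty => simpa using (h.inv_unique h1 h2.1).2
  obtain ⟨-, hy1, -⟩ := h.heap_ok y x.val x.stamp hy
  obtain ⟨-, ha1, -⟩ := h.heap_ok a x'.val x'.stamp ha
  rcases lt_trichotomy (g.inv y) (g.inv a) with hlt' | heq | hgt
  · obtain ⟨r, hr, hra⟩ := h.seq _ _ _ _ _ hyl hal hlt'
    obtain ⟨v, b, e, h1, h2, h3, h4⟩ := hpush y x l r hy hr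
    exact ⟨v, b, e, h1, h3, by omega⟩
  · have := eq_of_time_eq h.sorted hyl hal heq
    simp only [Event.inv.injEq] at this
    rw [this.2.2] at hlt
    omega
  -- The two pushes belong to one thread, so the earlier one returns, and is therefore stamped,
  -- before the later one begins. If `a` were the earlier one, it would also be inserted earlier.
  · obtain ⟨r, hr, hra⟩ := h.seq _ _ _ _ _ hal hyl hgt
    obtain ⟨v, b, e, h1, h2, h3, h4⟩ := hpush a x' l r ha hr
    omega

theorem Inv.stamp_le (h : c.Inv g) {y v b e} (hy : c.heap y = some ⟨v, .call b e⟩) :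
    g.ins y < b ∧ b < e ∧ e < c.clock := by
  obtain ⟨-, -, -, h5⟩ := h.heap_ok _ _ _ hy
  simp only [reduceCtorEq, Stamp.call.injEq, false_or] at h5
  obtain ⟨_, _, ⟨rfl, rfl⟩, h6⟩ := h5
  exact h6

/-- The timestamp of a node that is read in the traversal after the start time of the pop. -/
theorem Inv.stamp_eq_call (h : c.Inv g) {o st y x} (hst : StartOK g o st)
    (hy : c.heap y = some x) (hlt : ¬ st.Lt x.stamp) :
    ∃ b e, x = ⟨x.val, .call b e⟩ := by
  obtain ⟨b, e, rfl, -⟩ := hst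
  obtain ⟨-, -, -, h5⟩ := h.heap_ok y x.val x.stamp hy
  rcases h5 with h5 | ⟨b', e', h5, -⟩
  · rw [h5] at hlt
    simp [Stamp.Lt] at hlt
  · exact ⟨b', e', by cases x; simp_all⟩

theorem Inv.step (h : c.Inv g) {c' : Config n V} (hs : Step c c') : ∃ g', c'.Inv g' := by
  cases hs with
  | pushCall t v o hidle hfresh =>
    exact ⟨_, h.call hidle hfresh rfl fun h1 _ => ⟨by simp [emit, goto], h1⟩⟩
  | pushInsert t o v hloc => exact ⟨_, h.insert hloc⟩
  | pushBegin t o hloc =>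
    have hl := h.loc_ok t
    rw [hloc] at hl
    obtain ⟨v, h1, h2⟩ := hl
    refine ⟨g, h.silent (by rw [hloc]; rfl) ⟨v, h1, h2, (h.heap_ok _ _ _ h2).2.2.1, ?_⟩
      (by rw [hloc]; rfl)⟩
    simp [goto]
  | pushStamp t o b hloc =>
    have hl := h.loc_ok t
    rw [hloc] at hl
    obtain ⟨v, h1, h2, h3, h4⟩ := hl
    refine ⟨g, h.silent (by rw [hloc]; rfl) ⟨v, b, _, h1, h2, rfl, h3, h4, ?_⟩
      (by rw [hloc]; rfl)⟩
    simp [goto]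
  | pushSet t o ts x hloc hx => exact ⟨_, h.setStamp hloc hx⟩
  | pushReturn t o hloc =>
    have hl := h.loc_ok t
    rw [hloc] at hl
    exact ⟨_, h.return (by rw [hloc]; rfl) hl⟩
  | popCall t o hidle hfresh =>
    exact ⟨_, h.call hidle hfresh rfl fun _ h1 => ⟨by simp [emit, goto], h1⟩⟩
  | popBegin t o hloc =>
    have hl := h.loc_ok t
    rw [hloc] at hl
    refine ⟨g, h.silent (by rw [hloc]; rfl) ⟨hl, h.inv_lt hl.1, ?_⟩ (by rw [hloc]; rfl)⟩
    simp [goto]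
  | popStamp t o b hloc =>
    have hl := h.loc_ok t
    rw [hloc] at hl
    obtain ⟨h1, h2, h3⟩ := hl
    exact ⟨g, h.silent (by rw [hloc]; rfl) ⟨h1, b, _, rfl, h2, h3⟩ (by rw [hloc]; rfl)⟩
  | tryRem t o st hloc =>
    have hl := h.loc_ok t
    rw [hloc] at hl
    obtain ⟨h1, h2⟩ := hl
    exact ⟨g, h.silent (by rw [hloc]; rfl) ⟨h1, h2, by simp [Scan.init],
      ⟨by simp [Scan.init], by simp [Scan.init]⟩, by simp [Scan.init]⟩ (by rw [hloc]; rfl)⟩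
  | scanEmpty t o st s l hloc hl' hnil =>
    have hl := h.loc_ok t
    rw [hloc] at hl
    obtain ⟨h1, h2, h3, h4, h5⟩ := hl
    refine ⟨g, h.silent (by rw [hloc]; rfl) ⟨h1, h2, ?_, h4, ?_⟩ (by rw [hloc]; rfl)⟩
    · intro l₁ hl₁
      rcases Finset.mem_insert.1 hl₁ with rfl | hl₁
      · intro y hy
        change y ∈ (c.pool l₁).nodes at hy
        rw [hnil] at hy
        simp at hy
      · exact h3 l₁ hl₁
    · intro hc l₁ hl₁
      rcases Finset.mem_insert.1 hl₁ with rfl | hl₁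
      · exact ⟨(c.pool l₁).aba, by simp [Pool.top, hnil], le_rfl, fun _ => hnil⟩
      · have hne : l₁ ≠ l := fun hne => hl' (hne ▸ hl₁)
        obtain ⟨k, h6, h7⟩ := h5 hc l₁ hl₁
        exact ⟨k, by simpa [hne] using h6, h7⟩
  | scanNode t o st s l a hloc hl' hhead =>
    have hl := h.loc_ok t
    rw [hloc] at hl
    obtain ⟨h1, h2, h3, h4, h5⟩ := hl
    obtain ⟨tl, htl⟩ := List.head?_eq_some_iff.1 hhead
    obtain ⟨⟨v, sa, h6, h7⟩, -⟩ := h.pool_mem l a (by rw [htl]; simp)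
    refine ⟨g, h.silent (by rw [hloc]; rfl) ⟨h1, h2, ?_, h4, ?_, v, sa, h6, h7, ?_⟩
      (by rw [hloc]; rfl)⟩
    · intro l₁ hl₁ hne
      exact h3 l₁ ((Finset.mem_insert.1 hl₁).resolve_left hne)
    · intro hc l₁ hl₁ hne
      exact h5 hc l₁ ((Finset.mem_insert.1 hl₁).resolve_left hne)
    · intro y hy _
      change y ∈ (c.pool l).nodes at hy
      have h8 := h.pool_sorted l
      rw [htl] at hy h8
      rcases List.mem_cons.1 hy with rfl | hy
      · exact Or.inl rfl
      · exact Or.inr ((List.pairwise_cons.1 h8).1 y hy)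
  | readElim t o st s l a x hloc hx hlt =>
    have hl := h.loc_ok t
    rw [hloc] at hl
    obtain ⟨h1, h2, h3, h4, h5, -⟩ := hl
    refine ⟨g, h.silent (by rw [hloc]; rfl) ⟨h1, h2, Or.inl ?_⟩ (by rw [hloc]; rfl)⟩
    -- The timestamp of `a` begins after the start time ends, hence after the invocation of the pop;
    -- a return of the push is later still.
    intro t' r hr
    obtain ⟨bs, es, rfl, h6, h7⟩ := h2
    obtain ⟨⟨t₁, h8⟩, -⟩ := h.heap_ok a x.val x.stamp hx
    obtain ⟨h9, -⟩ := h.ret_ok _ _ _ hr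
    cases r with
    | done =>
      obtain ⟨v, b, e, -, h10, h11⟩ := h9
      have h12 := h.stamp_le h10
      obtain rfl := Option.some.inj (h10.symm.trans hx)
      simp only [Stamp.Lt] at hlt
      omega
    | val v => simpa using (h.inv_unique h8 h9.1).2
    | empty => simpa using (h.inv_unique h8 h9.1).2
  | readCand t o st s l a x hloc hx hlt hmax =>
    have hl := h.loc_ok t
    rw [hloc] at hl
    obtain ⟨h1, h2, h3, h4, h5, v, sa, h6, h7, h8⟩ := hl
    obtain ⟨b, e, hxe⟩ := h.stamp_eq_call h2 hx hlt
    have hbe := h.stamp_le (hx.trans (congrArg some hxe))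
    have hst : x.stamp = .call b e := by rw [hxe]
    refine ⟨g, h.silent (by rw [hloc]; rfl) ⟨h1, h2, ?_, ⟨by simp, ?_⟩, by simp⟩
      (by rw [hloc]; rfl)⟩
    -- In the list just read, `y` is `a` itself or was stamped before `a` was inserted. In the other
    -- lists the old bound `s.maxTS` carries over by transitivity, because the new value of `MaxTS`
    -- is bigger.
    · intro l₁ hl₁ y hy hyi
      by_cases hne : l₁ = l
      · subst hne
        rcases h8 y hy hyi with rfl | hya
        · refine ⟨x.val, b, e, hx.trans (congrArg some hxe), ?_⟩
          simp only [hst, Stamp.Lt]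
          omega
        · obtain ⟨⟨w, sw, h9, h10⟩, -⟩ := h.pool_mem l₁ y hy
          obtain ⟨w, b', e', h11, h12, h13⟩ := h.stamp_lt_of_ins_lt h9 h10 hx h7 hya
          refine ⟨w, b', e', h11, ?_⟩
          simp only [hst, Stamp.Lt]
          omega
      · obtain ⟨w, b', e', h9, h10⟩ := h3 l₁ hl₁ hne y hy hyi
        refine ⟨w, b', e', h9, fun h11 => h10 (hmax.trans ?_ h11)⟩
        intro b₁ e₁ h12
        rw [hst, Stamp.call.injEq] at h12
        omega
    · intro l₁ a₁ ha₁
      simp only [Option.some.injEq, Prod.mk.injEq] at ha₁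
      obtain ⟨rfl, rfl⟩ := ha₁
      exact ⟨x.val, b, e, hx.trans (congrArg some hxe), hst⟩
  | readSkip t o st s l a x hloc hx hlt hmax =>
    have hl := h.loc_ok t
    rw [hloc] at hl
    obtain ⟨h1, h2, h3, h4, h5, v, sa, h6, h7, h8⟩ := hl
    obtain ⟨b, e, hxe⟩ := h.stamp_eq_call h2 hx hlt
    have hbe := h.stamp_le (hx.trans (congrArg some hxe))
    have hst : x.stamp = .call b e := by rw [hxe]
    refine ⟨g, h.silent (by rw [hloc]; rfl) ⟨h1, h2, ?_, h4, ?_⟩ (by rw [hloc]; rfl)⟩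
    · intro l₁ hl₁ y hy hyi
      by_cases hne : l₁ = l
      · subst hne
        rcases h8 y hy hyi with rfl | hya
        · exact ⟨x.val, b, e, hx.trans (congrArg some hxe), by rwa [hst] at hmax⟩
        · obtain ⟨⟨w, sw, h9, h10⟩, -⟩ := h.pool_mem l₁ y hy
          obtain ⟨w, b', e', h11, h12, h13⟩ := h.stamp_lt_of_ins_lt h9 h10 hx h7 hya
          refine ⟨w, b', e', h11, fun h14 => hmax (h14.trans ?_ ?_)⟩
          · intro b₁ e₁ h15
            rw [Stamp.call.injEq] at h15
            omega
          · simp only [hst, Stamp.Lt]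
            omega
      · exact h3 l₁ hl₁ hne y hy hyi
    -- Without a candidate `MaxTS` is `-1`, which is below every generated timestamp, so the node
    -- could not have been skipped.
    · intro hc
      rw [h4.1 hc, hst] at hmax
      simp [Stamp.Lt] at hmax
  | scanEnd t o st s hloc huniv =>
    have hl := h.loc_ok t
    rw [hloc] at hl
    obtain ⟨h1, h2, h3, h4, h5⟩ := hl
    rw [huniv] at h3 h5
    exact ⟨g, h.silent (by rw [hloc]; rfl) ⟨h1, h2, fun l => h3 l (Finset.mem_univ l), h4,
      fun hc l => h5 hc l (Finset.mem_univ l)⟩ (by rw [hloc]; rfl)⟩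
  | decideEmpty t o st s hloc hc =>
    have hl := h.loc_ok t
    rw [hloc] at hl
    obtain ⟨h1, h2, h3, h4, h5⟩ := hl
    -- The current time serves as `k₀`. All removals so far are strictly earlier, so a list that is
    -- empty now has every inserted node removed before `k₀`.
    refine ⟨g, h.silent (by rw [hloc]; rfl) ⟨h1, h2, c.clock, h.inv_lt h1.1, by simp [goto],
      by simp, fun l => ?_⟩ (by rw [hloc]; rfl)⟩
    obtain ⟨k, h6, h7, h8⟩ := h5 hc l
    refine ⟨k, h6, h7, fun hk y x m hy hm => Or.inr ?_⟩
    by_contra hno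
    have h9 := h.pool_compl l m y x hy hm fun q hq =>
      hno ⟨q, hq, (h.match_ok q y hq).2.2.2.2⟩
    rw [h8 hk] at h9
    simp at h9
  | decideCand t o st s l a hloc hc =>
    have hl := h.loc_ok t
    rw [hloc] at hl
    obtain ⟨h1, h2, h3, h4, h5⟩ := hl
    obtain ⟨v, b, e, h6, h7⟩ := h4.2 l a hc
    rw [h7] at h3
    exact ⟨g, h.silent (by rw [hloc]; rfl) ⟨h1, h2, Or.inr ⟨v, b, e, h6, h3⟩⟩
      (by rw [hloc]; rfl)⟩
  | checkSame t o st em ch l hloc hl' htop =>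
    have hl := h.loc_ok t
    rw [hloc] at hl
    obtain ⟨h1, h2, k₀, h3, h4, h5, h6⟩ := hl
    refine ⟨g, h.silent (by rw [hloc]; rfl) ⟨h1, h2, k₀, h3, h4.trans (by simp [goto]), ?_, h6⟩
      (by rw [hloc]; rfl)⟩
    intro l₁ hl₁
    rcases Finset.mem_insert.1 hl₁ with rfl | hl₁
    · obtain ⟨k, h7, -, h8⟩ := h6 l₁
      rw [h7, Pool.top, Option.some.injEq, Prod.mk.injEq] at htop
      exact h8 htop.2
    · exact h5 l₁ hl₁
  | checkChanged t o st em ch l hloc hl' htop =>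
    have hl := h.loc_ok t
    rw [hloc] at hl
    exact ⟨g, h.silent (by rw [hloc]; rfl) ⟨hl.1, hl.2.1⟩ (by rw [hloc]; rfl)⟩
  | checkEnd t o st em ch hloc huniv =>
    have hl := h.loc_ok t
    rw [hloc] at hl
    obtain ⟨h1, h2, k₀, h3, h4, h5, h6⟩ := hl
    refine ⟨g, h.silent (by rw [hloc]; rfl) ⟨h1.1, h1.2, k₀, h3, h4.trans (by simp [goto]),
      fun l => h5 l (by rw [huniv]; exact Finset.mem_univ l)⟩ (by rw [hloc]; rfl)⟩
  | removeSuccess t o st l a x hloc ha hx => exact ⟨_, h.remove hloc ha hx⟩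
  | removeFail t o st l a hloc ha =>
    have hl := h.loc_ok t
    rw [hloc] at hl
    exact ⟨g, h.silent (by rw [hloc]; rfl) ⟨hl.1, hl.2.1⟩ (by rw [hloc]; rfl)⟩
  | popReturn t o r hloc =>
    have hl := h.loc_ok t
    rw [hloc] at hl
    exact ⟨_, h.return (by rw [hloc]; rfl) hl⟩

theorem Reachable.exists_inv (h : c.Reachable) : ∃ g, c.Inv g := by
  induction h with
  | refl => exact ⟨⟨id, id, id, id⟩, Inv.init n V _⟩
  | tail _ hs ih => exact ih.elim fun g hg => hg.step hs

/-! ### Timing data of a reachable state and the legal sequence -/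

/-- The operation `o` has returned. -/
def Returned (c : Config n V) (o : ℕ) : Prop := ∃ t r, Event.ret t r o ∈ c.hist

/-- The two events of the operation `o` once it has been completed. -/
def OpEvents (c : Config n V) (g : Ghost) (o : ℕ) (E : History n V) : Prop :=
  ∃ t m r, E = [.inv t m o, .ret t r o] ∧ Event.inv t m o ∈ c.hist ∧
    (∀ t' r', Event.ret t' r' o ∈ c.hist → t' = t ∧ r' = r) ∧
    ((∃ v st, m = .push v ∧ r = .done ∧ c.heap o = some ⟨v, st⟩) ∨
      (∃ v a st, m = .pop ∧ r = .val v ∧ c.matching o = some a ∧ c.heap a = some ⟨v, st⟩) ∨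
      (m = .pop ∧ r = .empty ∧ c.matching o = none ∧ Event.ret t r o ∈ c.hist ∧
        ∃ k, g.inv o < k ∧ k < g.ret o ∧ ∀ l, c.EmptyAt g l k))

/-- A matched operation may be pending, but its response is already determined: `done` for the push,
the value of the removed node for the pop. -/
theorem Inv.exists_opEvents (h : c.Inv g) {o : ℕ}
    (ho : c.Returned o ∨ (∃ a, c.matching o = some a) ∨ ∃ q, c.matching q = some o) :
    ∃ E, c.OpEvents g o E := by
  by_cases hr : c.Returned o
  · obtain ⟨t, r, hr⟩ := hr
    obtain ⟨h1, -⟩ := h.ret_ok _ _ _ hr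
    cases r with
    | done =>
      obtain ⟨v, b, e, h2, h3, h4⟩ := h1
      exact ⟨_, t, _, _, rfl, h2, fun t' r' hr' => h.ret_unique hr' hr,
        Or.inl ⟨v, _, rfl, rfl, h3⟩⟩
    | val v =>
      obtain ⟨h2, a, st, h3, h4, h5⟩ := h1
      exact ⟨_, t, _, _, rfl, h2, fun t' r' hr' => h.ret_unique hr' hr,
        Or.inr (Or.inl ⟨v, a, st, rfl, rfl, h3, h4⟩)⟩
    | empty =>
      obtain ⟨h2, h3, h4⟩ := h1
      exact ⟨_, t, _, _, rfl, h2, fun t' r' hr' => h.ret_unique hr' hr,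
        Or.inr (Or.inr ⟨rfl, rfl, h3, hr, h4⟩)⟩
  · rcases ho with ho | ⟨a, ha⟩ | ⟨q, hq⟩
    · exact absurd ho hr
    · obtain ⟨⟨t, h1⟩, ⟨⟨v, st⟩, h2⟩, -⟩ := h.match_ok _ _ ha
      exact ⟨_, t, .pop, .val v, rfl, h1, fun t' r' hr' => absurd ⟨t', r', hr'⟩ hr,
        Or.inr (Or.inl ⟨v, a, st, rfl, rfl, ha, h2⟩)⟩
    · obtain ⟨-, ⟨⟨v, st⟩, h2⟩, -⟩ := h.match_ok _ _ hq
      obtain ⟨⟨t, h1⟩, -⟩ := h.heap_ok _ _ _ h2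
      exact ⟨_, t, .push v, .done, rfl, h1, fun t' r' hr' => absurd ⟨t', r', hr'⟩ hr,
        Or.inl ⟨v, st, rfl, rfl, h2⟩⟩

theorem Inv.matching_none_of_heap (h : c.Inv g) {y x} (hy : c.heap y = some x) :
    c.matching y = none := by
  obtain ⟨⟨t, h1⟩, -⟩ := h.heap_ok y x.val x.stamp hy
  exact h.not_matched_of_push h1

theorem OpEvents.isPush (h : c.Inv g) {ev : ℕ → History n V} {y v st}
    (ho : c.OpEvents g y (ev y)) (hy : c.heap y = some ⟨v, st⟩) : IsPush ev y v := by
  obtain ⟨t, m, r, h1, h2, -, h3⟩ := ho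
  obtain ⟨⟨t', h4⟩, -⟩ := h.heap_ok y v st hy
  obtain ⟨rfl, rfl⟩ := h.inv_unique h2 h4
  rcases h3 with ⟨v', st', h5, rfl, h6⟩ | ⟨_, _, _, h5, _⟩ | ⟨h5, _⟩
  · exact ⟨t, h1⟩
  · simp at h5
  · simp at h5

theorem OpEvents.isPop (h : c.Inv g) {ev : ℕ → History n V} {o y v st}
    (ho : c.OpEvents g o (ev o)) (hm : c.matching o = some y) (hy : c.heap y = some ⟨v, st⟩) :
    IsPop ev o v := by
  obtain ⟨t, m, r, h1, h2, -, h3⟩ := ho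
  rcases h3 with ⟨v', st', h5, rfl, h6⟩ | ⟨_, a, _, rfl, rfl, h5, h6⟩ | ⟨_, _, h5, _⟩
  · rw [h.matching_none_of_heap h6] at hm
    simp at hm
  · obtain rfl := Option.some.inj (h5.symm.trans hm)
    rw [hy] at h6
    simp only [Option.some.injEq, Node.mk.injEq] at h6
    obtain ⟨rfl, rfl⟩ := h6
    exact ⟨t, h1⟩
  · rw [hm] at h5
    simp at h5

open scoped Classical in
/-- The time of the response, pending operations being completed in the end. -/
noncomputable def retTime (c : Config n V) (g : Ghost) (o : ℕ) : ℕ :=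
  if c.Returned o then g.ret o else c.clock + o

theorem retTime_of_ret {t r o} (h : Event.ret t r o ∈ c.hist) : c.retTime g o = g.ret o :=
  if_pos ⟨t, r, h⟩

theorem Inv.inv_lt_retTime (h : c.Inv g) {t m o} (ho : Event.inv t m o ∈ c.hist) :
    g.inv o < c.retTime g o := by
  unfold retTime
  split
  · next hr =>
    obtain ⟨t', r, hr⟩ := hr
    exact (h.ret_ok _ _ _ hr).2
  · have := h.inv_lt ho
    omega

theorem Inv.rem_lt_retTime (h : c.Inv g) {o a} (ho : c.matching o = some a) :
    g.rem a < c.retTime g o := by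
  unfold retTime
  split
  · next hr =>
    obtain ⟨t', r, hr⟩ := hr
    obtain ⟨h1, -⟩ := h.ret_ok _ _ _ hr
    cases r with
    | done =>
      obtain ⟨v, b, e, h2, _⟩ := h1
      rw [h.not_matched_of_push h2] at ho
      simp at ho
    | val v =>
      obtain ⟨_, a', _, h2, _, h3⟩ := h1
      obtain rfl := Option.some.inj (h2.symm.trans ho)
      exact h3
    | empty =>
      rw [h1.2.1] at ho
      simp at ho
  · have := (h.match_ok o a ho).2.2.2.2
    omega

open scoped Classical in
/-- The pop that removes the node `y`. -/
noncomputable def popOf (c : Config n V) (y : ℕ) : Option ℕ :=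
  if h : ∃ o, c.matching o = some y then some h.choose else none

theorem Inv.popOf_eq_some (h : c.Inv g) {y o} : c.popOf y = some o ↔ c.matching o = some y := by
  unfold popOf
  split
  · next hex =>
    rw [Option.some.injEq]
    exact ⟨fun ho => ho ▸ hex.choose_spec, fun ho => h.match_inj _ _ _ hex.choose_spec ho⟩
  · next hex => simpa using fun ho => hex ⟨o, ho⟩

/-- The beginning of the generation of the timestamp of a node. -/
def stampBegin (c : Config n V) (y : ℕ) : ℕ :=
  match c.heap y with
  | some ⟨_, .call b _⟩ => b
  | _ => 0

/-- The end of the generation of the timestamp of a node. -/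
def stampEnd (c : Config n V) (y : ℕ) : ℕ :=
  match c.heap y with
  | some ⟨_, .call _ e⟩ => e
  | _ => 0

/-- A push that has returned before the pop of its value begins, if there is one. -/
def Solid (c : Config n V) (g : Ghost) (y : ℕ) : Prop :=
  (∃ t, Event.ret t .done y ∈ c.hist) ∧ ∀ o, c.matching o = some y → g.ret y < g.inv o

theorem Solid.stamp (h : c.Inv g) {y} (hy : c.Solid g y) :
    ∃ v l, c.heap y = some ⟨v, .call (c.stampBegin y) (c.stampEnd y)⟩ ∧
      Event.inv l (.push v) y ∈ c.hist ∧
      g.inv y < g.ins y ∧ g.ins y < c.stampBegin y ∧ c.stampBegin y < c.stampEnd y ∧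
      c.stampEnd y < c.clock ∧ c.stampEnd y < g.ret y ∧ c.retTime g y = g.ret y := by
  obtain ⟨⟨t, hr⟩, -⟩ := hy
  obtain ⟨⟨v, b, e, h1, h2, h3⟩, -⟩ := h.ret_ok _ _ _ hr
  obtain ⟨h4, h5, h6⟩ := h.stamp_le h2
  have hb : c.stampBegin y = b := by simp [stampBegin, h2]
  have he : c.stampEnd y = e := by simp [stampEnd, h2]
  rw [hb, he]
  exact ⟨v, t, h2, h1, (h.heap_ok _ _ _ h2).2.1, h4, h5, h6, h3, retTime_of_ret hr⟩

/-- Solid values supply the timing data; the current time plays the role of `N`, and `Inv.order`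
provides the order condition. -/
theorem Inv.timed (h : c.Inv g) {ev : ℕ → History n V} {K D : Finset ℕ}
    (hev : ∀ o ∈ K, c.OpEvents g o (ev o))
    (hmatch : ∀ o a, c.matching o = some a → (o ∈ K ↔ a ∈ K))
    (hD : ∀ y, y ∈ D ↔ y ∈ K ∧ c.Solid g y) :
    Timed ev g.inv (c.retTime g) c.stampBegin c.stampEnd
      (fun y => (c.popOf y).elim c.clock g.inv)
      (fun y => (c.popOf y).elim c.clock fun _ => g.rem y) c.popOf c.clock D where
  push y hy := by
    obtain ⟨hyK, hy⟩ := (hD y).1 hy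
    obtain ⟨v, l, h1, -⟩ := hy.stamp h
    refine ⟨v, (hev y hyK).isPush h h1, fun o ho => ?_⟩
    rw [h.popOf_eq_some] at ho
    exact (hev o ((hmatch o y ho).2 hyK)).isPop h ho h1
  inv_lt y hy := by
    obtain ⟨v, l, h1, h2, h3, h4, h5, h6, h7, h8⟩ := ((hD y).1 hy).2.stamp h
    omega
  stamp_lt y hy := by
    obtain ⟨v, l, h1, h2, h3, h4, h5, h6, h7, h8⟩ := ((hD y).1 hy).2.stamp h
    omega
  lt_ret y hy := by
    obtain ⟨v, l, h1, h2, h3, h4, h5, h6, h7, h8⟩ := ((hD y).1 hy).2.stamp h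
    omega
  matched y hy o ho := by
    have ho' := h.popOf_eq_some.1 ho
    simp only [ho, Option.elim_some]
    refine ⟨trivial, h.rem_lt_retTime ho', (h.match_ok _ _ ho').2.2.2.2, fun hoD => ?_⟩
    obtain ⟨v, l, h1, -⟩ := ((hD o).1 hoD).2.stamp h
    rw [h.matching_none_of_heap h1] at ho'
    simp at ho'
  stamp_lt_pop y hy := by
    obtain ⟨v, l, h1, h2, h3, h4, h5, h6, h7, h8⟩ := ((hD y).1 hy).2.stamp h
    cases ho : c.popOf y with
    | none => exact h6
    | some o =>
      have := ((hD y).1 hy).2.2 o (h.popOf_eq_some.1 ho)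
      simp only [Option.elim_some]
      omega
  pop_le y hy := by
    cases ho : c.popOf y with
    | none => exact le_rfl
    | some o => exact (h.match_ok _ _ (h.popOf_eq_some.1 ho)).2.2.2.1.le
  unmatched y hy hno := by simp [hno]
  lt_end y hy := by
    obtain ⟨v, l, h1, h2, h3, h4, h5, h6, h7, h8⟩ := ((hD y).1 hy).2.stamp h
    exact h6
  inj y hy z hz o hyo hzo := by
    rw [h.popOf_eq_some] at hyo hzo
    exact Option.some.inj (hyo.symm.trans hzo)
  order z hz y hy hlt hr := by
    obtain ⟨v, l, h1, h2, h3, h4, h5, h6, h7, h8⟩ := ((hD y).1 hy).2.stamp h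
    obtain ⟨v', l', k1, -⟩ := ((hD z).1 hz).2.stamp h
    obtain ⟨-, ⟨t, hret⟩, hsol⟩ := (hD z).1 hz
    have hyr : (c.popOf y).elim c.clock (fun _ => g.rem y) ≤ c.clock := by
      cases ho : c.popOf y with
      | none => exact le_rfl
      | some o => exact (h.match_ok _ _ (h.popOf_eq_some.1 ho)).2.2.2.2.le
    cases ho : c.popOf z with
    | none =>
      simp only [ho, Option.elim_none] at hr
      omega
    | some o =>
      simp only [ho, Option.elim_some] at hr ⊢
      -- Otherwise the stamping of `y` begins no later than the invocation of the pop of `z`, so `y`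
      -- was inserted before that invocation, and `Inv.order` forbids that `z` has the smaller
      -- timestamp.
      by_contra hlt'
      have ho' := h.popOf_eq_some.1 ho
      obtain ⟨b, e, h9, h10⟩ := h.order o z t _ ho' hret (hsol o ho') y _ h1 (by omega) (by
        intro o' hy'
        rwa [h.popOf_eq_some.2 hy', Option.elim_some] at hr)
      simp only [Stamp.call.injEq] at h9
      obtain ⟨rfl, rfl⟩ := h9
      exact h10 _ k1 hlt

/-- The operations of `K` are of three kinds: those on solid values (`D`), pops returning EMPTY
(`E`), and overlapping pairs, indexed by their pops (`O`). The first two are arranged together, and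
then the pairs are inserted. -/
theorem Inv.exists_legal_list (h : c.Inv g) {ev : ℕ → History n V} {K : Finset ℕ}
    (hev : ∀ o ∈ K, c.OpEvents g o (ev o))
    (hret : ∀ o ∈ K, c.Returned o ∨ (∃ a, c.matching o = some a) ∨ ∃ q, c.matching q = some o)
    (hmatch : ∀ o a, c.matching o = some a → (o ∈ K ↔ a ∈ K)) :
    ∃ L : List ℕ, (∀ o, o ∈ L ↔ o ∈ K) ∧ L.Pairwise (Compatible g.inv (c.retTime g)) ∧
      LIFO [] (L.flatMap ev) := by
  classical
  set D := K.filter fun y => c.Solid g y with hDdef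
  have hD : ∀ y, y ∈ D ↔ y ∈ K ∧ c.Solid g y := fun y => Finset.mem_filter
  have hT := h.timed hev hmatch hD
  have hDheap : ∀ y ∈ D, ∃ x, c.heap y = some x := fun y hy => by
    obtain ⟨v, l, h1, -⟩ := ((hD y).1 hy).2.stamp h
    exact ⟨_, h1⟩
  set E := K.filter fun o => c.heap o = none ∧ c.matching o = none with hEdef
  have hE : ∀ o, o ∈ E ↔ o ∈ K ∧ c.heap o = none ∧ c.matching o = none :=
    fun y => Finset.mem_filter
  have hEev : ∀ o, ∃ k, o ∈ E → IsPopEmpty ev o ∧ g.inv o < k ∧ k < c.retTime g o ∧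
      ∀ l, c.EmptyAt g l k := by
    intro o
    by_cases ho : o ∈ E
    swap
    · exact ⟨0, fun h => absurd h ho⟩
    obtain ⟨hoK, h1, h2⟩ := (hE o).1 ho
    obtain ⟨t, m, r, h3, h4, -, h5⟩ := hev o hoK
    rcases h5 with ⟨v, st, _, _, h6⟩ | ⟨_, _, _, _, _, h6, _⟩ | ⟨rfl, rfl, _, h6, k, h7, h8, h9⟩
    · rw [h1] at h6; simp at h6
    · rw [h2] at h6; simp at h6
    · exact ⟨k, fun _ => ⟨⟨t, h3⟩, h7, by rwa [retTime_of_ret h6], h9⟩⟩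
  choose k hk using hEev
  obtain ⟨L, hL, pL, -, lL⟩ := hT.exists_list_of_empty k E (by
    intro o ho
    obtain ⟨h1, h2, h3, h4⟩ := hk o ho
    obtain ⟨hoK, h5, h6⟩ := (hE o).1 ho
    refine ⟨h1, h2.le, h3.le, ?_, ?_⟩
    · rintro (hoD | ⟨y, hy, hyo⟩)
      · obtain ⟨x, hx⟩ := hDheap o hoD
        rw [h5] at hx
        simp at hx
      · rw [h.popOf_eq_some, h6] at hyo
        simp at hyo
    · intro y hy
      obtain ⟨v, l, k1, k2, k3, k4, k5, -⟩ := ((hD y).1 hy).2.stamp h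
      rcases h4 l y _ _ k1 k2 with h7 | ⟨q, h7, h8⟩
      · right; omega
      · left
        rw [← h.popOf_eq_some] at h7
        simp [h7, h8])
  have hLops : ∀ o ∈ L, ∃ t m r, ev o = [.inv t m o, .ret t r o] ∧
      g.inv o ≤ c.retTime g o := by
    intro o ho
    have hoK : o ∈ K := by
      rcases (hL o).1 ho with (ho | ⟨y, hy, hyo⟩) | ho
      · exact ((hD o).1 ho).1
      · exact (hmatch o y (h.popOf_eq_some.1 hyo)).2 ((hD y).1 hy).1
      · exact ((hE o).1 ho).1
    obtain ⟨t, m, r, h3, h4, -⟩ := hev o hoK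
    exact ⟨t, m, r, h3, (h.inv_lt_retTime h4).le⟩
  set O := K.filter fun o => ∃ a, c.matching o = some a ∧ ¬ c.retTime g a < g.inv o with hOdef
  have hO : ∀ o, o ∈ O ↔ o ∈ K ∧ ∃ a, c.matching o = some a ∧ ¬ c.retTime g a < g.inv o :=
    fun y => Finset.mem_filter
  have hnotL : ∀ o a, c.matching o = some a → ¬ c.retTime g a < g.inv o → a ∉ L ∧ o ∉ L := by
    intro o a ha hlt
    obtain ⟨-, ⟨x, hx⟩, -⟩ := h.match_ok o a ha
    have hma := h.matching_none_of_heap hx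
    have haD : a ∉ D := by
      intro haD
      have hs := ((hD a).1 haD).2
      obtain ⟨_, _, _, _, _, _, _, _, _, h1⟩ := hs.stamp h
      have := hs.2 o ha
      omega
    rw [hL, hL]
    refine ⟨?_, ?_⟩
    · rintro ((haD' | ⟨y, hy, hyo⟩) | haE)
      · exact haD haD'
      · rw [h.popOf_eq_some, hma] at hyo
        simp at hyo
      · rw [((hE a).1 haE).2.1] at hx
        simp at hx
    · rintro ((hoD | ⟨y, hy, hyo⟩) | hoE)
      · obtain ⟨x', hx'⟩ := hDheap o hoD
        rw [h.matching_none_of_heap hx'] at ha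
        simp at ha
      · rw [h.popOf_eq_some] at hyo
        obtain rfl := Option.some.inj (hyo.symm.trans ha)
        exact haD hy
      · rw [((hE o).1 hoE).2.2] at ha
        simp at ha
  obtain ⟨L', hL', pL', lL'⟩ := exists_list_of_elim
    -- All pops in `O` are matched, so the default value `0` is never used.
    (O.toList.map fun o => ((c.matching o).getD 0, o)) pL
    (fun o ho => (hLops o ho).choose_spec.choose_spec.choose_spec.2)
    (fun o ho => by
      obtain ⟨t, m, r, h1, -⟩ := hLops o ho
      simp [h1]) lL (by
    intro p hp
    obtain ⟨o, ho, rfl⟩ := List.mem_map.1 hp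
    obtain ⟨hoK, a, ha, hlt⟩ := (hO o).1 (Finset.mem_toList.1 ho)
    obtain ⟨⟨t, h1⟩, ⟨⟨v, st⟩, h2⟩, h3, h4, -⟩ := h.match_ok o a ha
    obtain ⟨⟨t', h5⟩, h6, -⟩ := h.heap_ok _ _ _ h2
    have h7 := h.rem_lt_retTime ha
    simp only [ha, Option.getD_some]
    exact ⟨⟨v, (hev a ((hmatch o a ha).1 hoK)).isPush h h2, (hev o hoK).isPop h ha h2⟩,
      (h.inv_lt_retTime h5).le, (h.inv_lt_retTime h1).le, by omega, by omega,
      hnotL o a ha hlt⟩) (by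
    rw [List.flatMap_map, List.nodup_flatMap]
    refine ⟨?_, ?_⟩
    · intro o ho
      obtain ⟨hoK, a, ha, hlt⟩ := (hO o).1 (Finset.mem_toList.1 ho)
      obtain ⟨-, ⟨x, hx⟩, -⟩ := h.match_ok o a ha
      have hma := h.matching_none_of_heap hx
      simp only [ha, Option.getD_some, List.nodup_cons, List.mem_cons, List.not_mem_nil, or_false,
        not_false_eq_true, List.nodup_nil, and_true]
      rintro rfl
      rw [ha] at hma
      simp at hma
    · refine (Finset.nodup_toList O).imp_of_mem ?_
      intro o o' ho ho' hne
      obtain ⟨hoK, a, ha, hlt⟩ := (hO o).1 (Finset.mem_toList.1 ho)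
      obtain ⟨hoK', a', ha', hlt'⟩ := (hO o').1 (Finset.mem_toList.1 ho')
      obtain ⟨-, ⟨x, hx⟩, -⟩ := h.match_ok o a ha
      have hma := h.matching_none_of_heap hx
      obtain ⟨-, ⟨x', hx'⟩, -⟩ := h.match_ok o' a' ha'
      have hma' := h.matching_none_of_heap hx'
      simp only [Function.onFun, ha, ha', Option.getD_some, List.disjoint_left, List.mem_cons,
        List.not_mem_nil, or_false, not_or]
      rintro q (rfl | rfl)
      · refine ⟨?_, ?_⟩
        · rintro rfl; exact hne (h.match_inj _ _ _ ha ha')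
        · rintro rfl; rw [ha'] at hma; simp at hma
      · refine ⟨?_, hne⟩
        rintro rfl; rw [ha] at hma'; simp at hma')
  refine ⟨L', fun o => ?_, pL', lL'⟩
  have hpair : (∃ p ∈ O.toList.map (fun o => ((c.matching o).getD 0, o)), o = p.1 ∨ o = p.2) ↔
      ∃ q ∈ O, o = (c.matching q).getD 0 ∨ o = q := by
    simp
  rw [hL', hL, hpair]
  -- A push that is still pending has a completed return time not before the current time, so a push
  -- whose return time precedes the pop has really returned.
  have hsolid : ∀ q a, c.matching q = some a → c.retTime g a < g.inv q → a ∈ K → a ∈ D := by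
    intro q a ha hlt haK
    obtain ⟨⟨t, h1⟩, ⟨⟨v, st⟩, h2⟩, -⟩ := h.match_ok q a ha
    obtain ⟨⟨t', h5⟩, -⟩ := h.heap_ok _ _ _ h2
    have hr : c.Returned a := by
      by_contra hr
      have := h.inv_lt h1
      rw [retTime, if_neg hr] at hlt
      omega
    obtain ⟨t₂, r, hr⟩ := hr
    obtain ⟨t₃, m, r', h6, h7, h8, h9⟩ := hev a haK
    obtain ⟨-, rfl⟩ := h8 _ _ hr
    rw [retTime_of_ret hr] at hlt
    refine (hD a).2 ⟨haK, ⟨t₂, ?_⟩, ?_⟩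
    · rcases h9 with ⟨_, _, _, rfl, _⟩ | ⟨_, _, _, rfl, _⟩ | ⟨rfl, _⟩
      · exact hr
      · simpa using (h.inv_unique h5 h7).2
      · simpa using (h.inv_unique h5 h7).2
    · intro q' hq'
      rwa [h.match_inj _ _ _ hq' ha]
  constructor
  · rintro (((ho | ⟨y, hy, hyo⟩) | ho) | ⟨q, hq, ho⟩)
    · exact ((hD o).1 ho).1
    · exact (hmatch o y (h.popOf_eq_some.1 hyo)).2 ((hD y).1 hy).1
    · exact ((hE o).1 ho).1
    · obtain ⟨hqK, a, ha, -⟩ := (hO q).1 hq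
      rw [ha, Option.getD_some] at ho
      rcases ho with rfl | rfl
      · exact (hmatch q _ ha).1 hqK
      · exact hqK
  · intro hoK
    cases hx : c.heap o with
    | some x =>
      by_cases hm : ∃ q, c.matching q = some o
      · obtain ⟨q, hq⟩ := hm
        by_cases hlt : c.retTime g o < g.inv q
        · exact Or.inl (Or.inl (Or.inl (hsolid q o hq hlt hoK)))
        · exact Or.inr ⟨q, (hO q).2 ⟨(hmatch q o hq).2 hoK, o, hq, hlt⟩, by simp [hq]⟩
      · left; left; left
        have hmo := h.matching_none_of_heap hx
        obtain ⟨t, r, hr⟩ : c.Returned o := by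
          rcases hret o hoK with hr | ⟨a, ha⟩ | hq
          · exact hr
          · rw [hmo] at ha; simp at ha
          · exact absurd hq hm
        obtain ⟨⟨t', h5⟩, -⟩ := h.heap_ok o x.val x.stamp hx
        obtain ⟨t₃, m, r', h6, h7, h8, h9⟩ := hev o hoK
        obtain ⟨-, rfl⟩ := h8 _ _ hr
        refine (hD o).2 ⟨hoK, ⟨t, ?_⟩, fun q hq => absurd ⟨q, hq⟩ hm⟩
        rcases h9 with ⟨_, _, _, rfl, _⟩ | ⟨_, _, _, rfl, _⟩ | ⟨rfl, _⟩
        · exact hr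
        · simpa using (h.inv_unique h5 h7).2
        · simpa using (h.inv_unique h5 h7).2
    | none =>
      cases hm : c.matching o with
      | none => exact Or.inl (Or.inr ((hE o).2 ⟨hoK, hx, hm⟩))
      | some a =>
        by_cases hlt : c.retTime g a < g.inv o
        · exact Or.inl (Or.inl (Or.inr ⟨a, hsolid o a hm hlt ((hmatch o a hm).1 hoK),
            h.popOf_eq_some.2 hm⟩))
        · exact Or.inr ⟨o, (hO o).2 ⟨hoK, a, hm, hlt⟩, Or.inr rfl⟩

/-! ### Completions and the two forms of linearizability -/

/-- The operations of a set `K` that contains only operations that have returned or are matched,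
and contains an operation together with the one it is matched with, can be completed and
linearized. -/
theorem Inv.exists_completion (h : c.Inv g) {K : Finset ℕ}
    (hret : ∀ o ∈ K, c.Returned o ∨ (∃ a, c.matching o = some a) ∨ ∃ q, c.matching q = some o)
    (hmatch : ∀ o a, c.matching o = some a → (o ∈ K ↔ a ∈ K)) :
    ∃ R S : History n V,
      (∀ e ∈ R, ∃ t m r o, e = .ret t r o ∧ Event.inv t m o ∈ c.hist ∧ o ∈ K ∧ ¬ c.Returned o) ∧
      (R.map Event.op).Nodup ∧
      Complete (c.hist.filter (fun e => e.op ∈ K) ++ R) ∧ LIFO [] S ∧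
      (∀ t, History.restrict (c.hist.filter (fun e => e.op ∈ K) ++ R) t = S.restrict t) ∧
      ∀ o o', Precedes (c.hist.filter (fun e => e.op ∈ K) ++ R) o o' → S.Precedes o o' := by
  classical
  have hex : ∀ o, ∃ E, o ∈ K → c.OpEvents g o E := fun o => by
    by_cases ho : o ∈ K
    · obtain ⟨E, hE⟩ := h.exists_opEvents (hret o ho)
      exact ⟨E, fun _ => hE⟩
    · exact ⟨[], fun h => absurd h ho⟩
  choose ev hev using hex
  obtain ⟨L, hL, pL, lL⟩ := h.exists_legal_list hev hret hmatch
  -- Responses are appended in the order of the identifiers, which matches the fictitious return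
  -- times `c.clock + o` of pending operations.
  set U := (K.filter fun o => ¬ c.Returned o).sort (· ≤ ·) with hU
  have hmemU : ∀ o, o ∈ U ↔ o ∈ K ∧ ¬ c.Returned o := fun o => by simp [hU]
  set R : History n V := U.flatMap fun o => (ev o).drop 1 with hRdef
  have hR : ∀ e ∈ R, ∃ t m r o, e = .ret t r o ∧ Event.inv t m o ∈ c.hist ∧ o ∈ K ∧
      ¬ c.Returned o ∧ e ∈ ev o := by
    intro e he
    obtain ⟨o, ho, he⟩ := List.mem_flatMap.1 he
    obtain ⟨hoK, hor⟩ := (hmemU o).1 ho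
    obtain ⟨t, m, r, h1, h2, -⟩ := hev o hoK
    simp only [h1, List.drop_succ_cons, List.drop_zero, List.mem_singleton] at he
    exact ⟨t, m, r, o, he, h2, hoK, hor, by simp [h1, he]⟩
  have hRpair : R.Pairwise fun e e' =>
      e.time g.inv (c.retTime g) < e'.time g.inv (c.retTime g) := by
    rw [hRdef, List.pairwise_flatMap]
    refine ⟨fun o ho => ?_, ?_⟩
    · obtain ⟨hoK, hor⟩ := (hmemU o).1 ho
      obtain ⟨t, m, r, h1, h2, -⟩ := hev o hoK
      simp [h1]
    · refine (Finset.sortedLT_sort _).pairwise.imp_of_mem ?_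
      intro o o' ho ho' hlt e he e' he'
      obtain ⟨hoK, hor⟩ := (hmemU o).1 ho
      obtain ⟨hoK', hor'⟩ := (hmemU o').1 ho'
      obtain ⟨t, m, r, h1, h2, -⟩ := hev o hoK
      obtain ⟨t', m', r', h1', h2', -⟩ := hev o' hoK'
      simp only [h1, h1', List.drop_succ_cons, List.drop_zero, List.mem_singleton] at he he'
      subst he he'
      simp only [Event.time, retTime, if_neg hor, if_neg hor']
      omega
  have htime : ∀ e ∈ c.hist, e.time g.inv (c.retTime g) = e.time g.inv g.ret := by
    intro e he
    cases e with
    | inv _ _ q => rfl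
    | ret _ _ q => exact retTime_of_ret he
  have hC : (c.hist.filter (fun e => e.op ∈ K) ++ R).Pairwise fun e e' =>
      e.time g.inv (c.retTime g) < e'.time g.inv (c.retTime g) := by
    rw [List.pairwise_append]
    refine ⟨(h.sorted.imp_of_mem ?_).sublist List.filter_sublist, hRpair, ?_⟩
    · intro e e' he he' hlt
      rwa [htime e he, htime e' he']
    · intro e he e' he'
      obtain ⟨t, m, r, o, rfl, -, -, hor, -⟩ := hR e' he'
      have hec := (List.mem_filter.1 he).1
      have := h.time_lt e hec
      rw [htime e hec]
      simp only [Event.time, retTime, if_neg hor]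
      change e.time g.inv g.ret < _
      omega
  have hmem : ∀ e, e ∈ c.hist.filter (fun e => e.op ∈ K) ++ R ↔ ∃ o ∈ L, e ∈ ev o := by
    intro e
    rw [List.mem_append, List.mem_filter]
    constructor
    · rintro (⟨he, hK⟩ | he)
      · simp only [decide_eq_true_eq] at hK
        refine ⟨e.op, (hL _).2 hK, ?_⟩
        obtain ⟨t, m, r, h1, h2, h3, -⟩ := hev _ hK
        rw [h1]
        cases e with
        | inv t' m' o =>
          obtain ⟨rfl, rfl⟩ := h.inv_unique h2 he
          simp [Event.op]
        | ret t' r' o =>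
          obtain ⟨rfl, rfl⟩ := h3 _ _ he
          simp [Event.op]
      · obtain ⟨t, m, r, o, -, -, hoK, -, heo⟩ := hR e he
        exact ⟨o, (hL o).2 hoK, heo⟩
    · rintro ⟨o, ho, he⟩
      have hoK := (hL o).1 ho
      obtain ⟨t, m, r, h1, h2, h3, -⟩ := hev o hoK
      have he' := he
      simp only [h1, List.mem_cons, List.not_mem_nil, or_false] at he'
      rcases he' with rfl | rfl
      · exact Or.inl ⟨h2, decide_eq_true hoK⟩
      · by_cases hor : c.Returned o
        · obtain ⟨t', r', hr⟩ := hor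
          obtain ⟨rfl, rfl⟩ := h3 _ _ hr
          exact Or.inl ⟨hr, decide_eq_true hoK⟩
        · exact Or.inr (List.mem_flatMap.2 ⟨o, (hmemU o).2 ⟨hoK, hor⟩, by simp [h1]⟩)
  have hCinv : ∀ t m o, Event.inv t m o ∈ c.hist.filter (fun e => e.op ∈ K) ++ R →
      Event.inv t m o ∈ c.hist ∧ o ∈ K := by
    intro t m o ho
    rcases List.mem_append.1 ho with ho | ho
    · obtain ⟨h1, h2⟩ := List.mem_filter.1 ho
      exact ⟨h1, of_decide_eq_true h2⟩
    · obtain ⟨t, m, r, o, h1, -⟩ := hR _ ho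
      simp at h1
  obtain ⟨h1, h2⟩ := restrict_eq_and_precedes hC (L := L) (ev := ev)
    (fun o ho => by
      obtain ⟨t, m, r, h1, h2, -⟩ := hev o ((hL o).1 ho)
      exact ⟨t, m, r, h1, h.inv_lt_retTime h2⟩) hmem pL
    (fun t m m' o o' ho ho' hlt => by
      obtain ⟨r, h3, h4⟩ := h.seq t m m' o o' (hCinv _ _ _ ho).1 (hCinv _ _ _ ho').1 hlt
      rwa [retTime_of_ret h3])
  refine ⟨R, L.flatMap ev, ?_, ?_, ?_, lL, h1, h2⟩
  · intro e he
    obtain ⟨t, m, r, o, h3, h4, h5, h6, -⟩ := hR e he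
    exact ⟨t, m, r, o, h3, h4, h5, h6⟩
  · rw [List.Nodup, List.pairwise_map]
    refine hRpair.imp_of_mem ?_
    intro e e' he he' hlt heq
    obtain ⟨t, m, r, o, rfl, -⟩ := hR e he
    obtain ⟨t', m', r', o', rfl, -⟩ := hR e' he'
    simp only [Event.op] at heq
    subst heq
    simp [Event.time] at hlt
  · intro t m o ho
    obtain ⟨h3, hoK⟩ := hCinv _ _ _ ho
    obtain ⟨t', m', r, h4, h5, -⟩ := hev o hoK
    obtain ⟨rfl, rfl⟩ := h.inv_unique h3 h5
    exact ⟨r, (hmem _).2 ⟨o, (hL o).2 hoK, by simp [h4]⟩⟩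

theorem Inv.linearizable (h : c.Inv g) : c.hist.Linearizable := by
  classical
  let ops : Finset ℕ := (c.hist.map Event.op).toFinset
  have hops : ∀ o, o ∈ ops ↔ ∃ e ∈ c.hist, e.op = o := fun o => by simp [ops]
  -- A pending push whose node has not been removed is dropped, as is a pending pop that has not
  -- removed a node. A matched operation is kept even if it is pending.
  let K : Finset ℕ := ops.filter fun o =>
    c.Returned o ∨ (∃ a, c.matching o = some a) ∨ ∃ q, c.matching q = some o
  have hK : ∀ o, o ∈ K ↔ o ∈ ops ∧
      (c.Returned o ∨ (∃ a, c.matching o = some a) ∨ ∃ q, c.matching q = some o) :=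
    fun o => Finset.mem_filter
  obtain ⟨R, S, hR, hnodup, hcomp, hS, hres, hprec⟩ := h.exists_completion (K := K)
    (fun o ho => ((hK o).1 ho).2) (by
      intro o a ha
      obtain ⟨⟨t, h1⟩, ⟨⟨v, st⟩, h2⟩, -⟩ := h.match_ok o a ha
      obtain ⟨⟨t', h3⟩, -⟩ := h.heap_ok _ _ _ h2
      rw [hK, hK]
      exact iff_of_true ⟨(hops o).2 ⟨_, h1, rfl⟩, Or.inr (Or.inl ⟨a, ha⟩)⟩
        ⟨(hops a).2 ⟨_, h3, rfl⟩, Or.inr (Or.inr ⟨o, ha⟩)⟩)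
  have hfilter : c.hist.filter (fun e => e.op ∈ K) = c.hist.filter (fun e => e.op ∉ ops \ K) := by
    refine List.filter_congr fun e he => ?_
    have : e.op ∈ ops := (hops _).2 ⟨e, he, rfl⟩
    simp [this]
  refine ⟨_, S, ⟨ops \ K, R, ?_, ?_, hnodup, by rw [hfilter], hcomp⟩, hS, hres, hprec⟩
  · intro o ho
    obtain ⟨ho, hoK⟩ := Finset.mem_sdiff.1 ho
    have hor : ¬ c.Returned o := fun hor => hoK ((hK o).2 ⟨ho, Or.inl hor⟩)
    refine ⟨?_, hor⟩
    obtain ⟨e, he, rfl⟩ := (hops o).1 ho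
    cases e with
    | inv t m q => exact ⟨t, m, he⟩
    | ret t r q => exact absurd ⟨t, r, he⟩ hor
  · intro e he
    obtain ⟨t, m, r, o, h1, h2, h3, h4⟩ := hR e he
    exact ⟨t, m, r, o, h1, h2, ⟨⟨t, m, h2⟩, h4⟩, fun h => (Finset.mem_sdiff.1 h).2 h3⟩

/-- Each operation has at most one partner, so deleting elimination pairs leaves a set closed under
matching. Since the history is complete, no response has to be added. -/
theorem Inv.commonHist_linearizable (h : c.Inv g) (hcomplete : c.hist.Complete) :
    c.commonHist.Linearizable := by
  classical
  let ops : Finset ℕ := (c.hist.map Event.op).toFinset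
  have hops : ∀ o, o ∈ ops ↔ ∃ e ∈ c.hist, e.op = o := fun o => by simp [ops]
  let K : Finset ℕ := ops.filter fun q => ¬ ∃ a o, c.IsElimPair a o ∧ (q = a ∨ q = o)
  have hK : ∀ o, o ∈ K ↔ o ∈ ops ∧ ¬ ∃ a q, c.IsElimPair a q ∧ (o = a ∨ o = q) :=
    fun o => Finset.mem_filter
  have hmn : ∀ o a, c.matching o = some a → c.matching a = none := by
    intro o a ha
    obtain ⟨-, ⟨x, hx⟩, -⟩ := h.match_ok o a ha
    exact h.matching_none_of_heap hx
  obtain ⟨R, S, hR, hnodup, hcomp, hS, hres, hprec⟩ := h.exists_completion (K := K)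
    (fun o ho => by
      obtain ⟨e, he, rfl⟩ := (hops o).1 ((hK o).1 ho).1
      cases e with
      | inv t m q =>
        obtain ⟨r, hr⟩ := hcomplete t m q he
        exact Or.inl ⟨t, r, hr⟩
      | ret t r q => exact Or.inl ⟨t, r, he⟩) (by
      intro o a ha
      obtain ⟨⟨t, h1⟩, ⟨⟨v, st⟩, h2⟩, -⟩ := h.match_ok o a ha
      obtain ⟨⟨t', h3⟩, -⟩ := h.heap_ok _ _ _ h2
      rw [hK, hK]
      refine and_congr (iff_of_true ((hops o).2 ⟨_, h1, rfl⟩) ((hops a).2 ⟨_, h3, rfl⟩))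
        (not_congr ?_)
      constructor
      · rintro ⟨a', o', hel, rfl | rfl⟩
        · rw [hmn _ _ hel.1] at ha
          simp at ha
        · obtain rfl := Option.some.inj (hel.1.symm.trans ha)
          exact ⟨_, _, hel, Or.inl rfl⟩
      · rintro ⟨a', o', hel, rfl | rfl⟩
        · obtain rfl := h.match_inj _ _ _ hel.1 ha
          exact ⟨_, _, hel, Or.inr rfl⟩
        · have h4 := hel.1
          rw [hmn _ _ ha] at h4
          simp at h4)
  have hR0 : R = [] := by
    rw [List.eq_nil_iff_forall_not_mem]
    intro e he
    obtain ⟨t, m, r, o, h1, h2, h3, h4⟩ := hR e he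
    obtain ⟨r', hr'⟩ := hcomplete t m o h2
    exact h4 ⟨t, r', hr'⟩
  subst hR0
  rw [List.append_nil] at hcomp hres hprec
  have hfilter : c.commonHist = c.hist.filter (fun e => e.op ∈ K) := by
    refine List.filter_congr fun e he => ?_
    have : e.op ∈ ops := (hops _).2 ⟨e, he, rfl⟩
    rw [decide_eq_decide, hK]
    exact ⟨fun h => ⟨this, h⟩, fun h => h.2⟩
  rw [hfilter]
  exact ⟨_, S, ⟨∅, [], by simp, by simp, by simp, by simp, hcomp⟩, hS, hres, hprec⟩

end Config

end TSStack

theorem theorem7p1 (n : ℕ) (V : Type*) :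
    (∀ c : TSStack.Config n V, c.Reachable → c.hist.Complete → c.commonHist.Linearizable) ∧
    (∀ c : TSStack.Config n V, c.Reachable → c.hist.Linearizable) :=
  ⟨fun _ h hc => h.exists_inv.elim fun _ hg => hg.commonHist_linearizable hc,
    fun _ h => h.exists_inv.elim fun _ hg => hg.linearizable⟩
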